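/- Throughout, graphs are finite and simple; $v(G)$ is the number of nodes, and $\hom(F,G)$ and $\mathrm{inj}(F,G)$ are the numbers of homomorphisms and of injective homomorphisms from $F$ to $G$. A pair $(G,d)$ is admissible if $d\ge 1$ is real and $G$ is a graph with all degrees $\le d$; for connected $F$ and $v(G)\ge 1$ put $t(F,G,d)=\hom(F,G)/\bigl(v(G)\,d^{\,v(F)-1}\bigr)$. Let $f$ be an isomorphism-invariant monic multiplicative graph polynomial of linearly bounded exponential type: to every graph $G$ a monic polynomial $f(G,x)\in\mathbb C[x]$ of degree $v(G)$ is assigned such that $f(G_1,x)=f(G_2,x)$ if $G_1\simeq G_2$; $f(G_1\sqcup G_2,x)=f(G_1,x)f(G_2,x)$ for disjoint unions; $f(G,x+y)=\sum_{S\subseteq V(G)}f(G[S],x)\,f(G[V(G)\setminus S],y)$ for all $G$; and there is a constant $b$ such that $\sum\{|f'(G[S],0)| : v\in S\subseteq V(G),\ |S|=t\}\le (bd)^{t-1}$ for all integers $d\ge 0$, all $G$ with maximal degree $\le d$, all $v\in V(G)$ and all $t\ge 1$. Let $p_k(G)$ be the $k$-th power sum of the roots of $f(G,x)$ (with multiplicity).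 (A) There are constants $c_k(F)\in\mathbb C$ (depending only on $f$, on $k$ and on the isomorphism class of the connected graph $F$) with $c_0(K_1)=1$ and $$p_k(G)=\sum_{2\le v(F)\le k+1}c_k(F)\,\mathrm{inj}(F,G)\qquad\text{for all } k\ge 1 \text{ and all } G,$$ where $F$ runs over the isomorphism classes of connected graphs. (B) There is a constant $C$ depending only on $f$ such that for every admissible $(G,d)$ all roots of $f(G,x)$ have absolute value $\le Cd$. (C) Let $c_k(F)$ be any constants as in (A) and $C$ any constant as in (B). Let $(G_n,d_n)$ be a sequence of admissible pairs with $v(G_n)\ge1$ and $d_n\to\infty$, such that for every connected graph $F$ with $c_{v(F)-1}(F)\ne 0$ the sequence $t(F,G_n,d_n)$ converges, to $t(F)$ say. (This holds in particular if $(G_n,d_n)$ is convergent, i.e. if $t(F,G_n,d_n)$ converges for every connected $F$.) Let $\nu_n$ be the uniform probability measure on the $v(G_n)$ points $\lambda/d_n$, where $\lambda$ runs over the roots of $f(G_n,x)$ with multiplicity. Then: 1. For all $k\ge 0$, $$\int z^k\,d\nu_n(z)\to\sum_{v(F)=k+1}c_k(F)\,t(F)\qquad(n\to\infty),$$ the sum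 being over isomorphism classes of connected graphs $F$ (terms with $c_k(F)=0$ are $0$). 2. For any (real- or complex-valued) function $g$ that is continuous for $|z|\le C$ and harmonic for $|z|<C$, the integral $\int g\,d\nu_n$ converges as $n\to\infty$. 3. For any $\xi\in\mathbb C$ with $|\xi|>C$, the normalized absolute value $|f(G_n,\xi d_n)|^{1/v(G_n)}/d_n$ converges to a positive limit. 4. If $f(G_n,x)$ has only real roots for all $n$, then $\nu_n$ converges weakly to a probability measure. -/

import Mathlib

open Filter Topology MeasureTheory Polynomial
open scoped SimpleGraph

noncomputable section

/-- A pair `(G, d)` is admissible if `d ≥ 1` and all degrees of `G` are at most `d`. -/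
def IsAdmissible {V : Type} (G : SimpleGraph V) (d : ℝ) : Prop :=
  1 ≤ d ∧ ∀ v : V, ((G.neighborSet v).ncard : ℝ) ≤ d

/-- The number of homomorphisms from `F` to `G`. -/
def homCount {U V : Type} (F : SimpleGraph U) (G : SimpleGraph V) : ℕ :=
  Nat.card (F →g G)

/-- The number of injective homomorphisms from `F` to `G`. -/
def injCount {U V : Type} (F : SimpleGraph U) (G : SimpleGraph V) : ℕ :=
  Nat.card {φ : F →g G // Function.Injective φ}

/-- The homomorphism density `t(F, G, d) = hom(F, G) / (v(G) d ^ (v(F) - 1))` of a connected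
graph `F` in an admissible pair `(G, d)`. -/
def homDensity {U V : Type} (F : SimpleGraph U) (G : SimpleGraph V) (d : ℝ) : ℝ :=
  (homCount F G : ℝ) / ((Nat.card V : ℝ) * d ^ (Nat.card U - 1))

/-- A polynomial with complex coefficients for every finite simple graph. -/
abbrev GraphPolynomial : Type 1 :=
  ∀ (V : Type) [Finite V], SimpleGraph V → ℂ[X]

open Classical in
/-- `f` is an isomorphism-invariant monic multiplicative graph polynomial of linearly bounded
exponential type. -/
structure IsLinearlyBoundedExpType (f : GraphPolynomial) : Prop where
  monic : ∀ (V : Type) [Finite V] (G : SimpleGraph V), (f V G).Monic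
  natDegree_eq : ∀ (V : Type) [Finite V] (G : SimpleGraph V), (f V G).natDegree = Nat.card V
  iso_inv : ∀ (V W : Type) [Finite V] [Finite W] (G : SimpleGraph V) (H : SimpleGraph W),
    Nonempty (G ≃g H) → f V G = f W H
  multiplicative : ∀ (V W : Type) [Finite V] [Finite W] (G : SimpleGraph V) (H : SimpleGraph W),
    f (V ⊕ W) (G ⊕g H) = f V G * f W H
  exponential : ∀ (V : Type) [Fintype V] (G : SimpleGraph V) (x y : ℂ),
    (f V G).eval (x + y) =
      ∑ S : Finset V, (f _ (G.induce (S : Set V))).eval x *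
        (f _ (G.induce ((S : Set V)ᶜ))).eval y
  bounded : ∃ b : ℝ, ∀ (V : Type) [Fintype V] (G : SimpleGraph V) (d : ℕ),
    (∀ v : V, (G.neighborSet v).ncard ≤ d) → ∀ (v : V) (t : ℕ), 1 ≤ t →
      ∑ S : Finset V with v ∈ S ∧ S.card = t,
        ‖(derivative (f _ (G.induce (S : Set V)))).eval 0‖ ≤ (b * d) ^ (t - 1)

/-- Isomorphism of graphs on the node set `Fin m`. -/
def graphIsoSetoid (m : ℕ) : Setoid (SimpleGraph (Fin m)) where
  r F F' := Nonempty (F ≃g F')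
  iseqv :=
    { refl := fun _ => ⟨RelIso.refl _⟩
      symm := fun ⟨e⟩ => ⟨e.symm⟩
      trans := fun ⟨e⟩ ⟨e'⟩ => ⟨e.trans e'⟩ }

/-- Isomorphism classes of graphs with `m` nodes. -/
def GraphClass (m : ℕ) : Type := Quotient (graphIsoSetoid m)

/-- A representative of an isomorphism class. -/
def GraphClass.rep {m : ℕ} (F : GraphClass m) : SimpleGraph (Fin m) := Quotient.out F

instance (m : ℕ) : Finite (GraphClass m) :=
  inferInstanceAs (Finite (Quotient (graphIsoSetoid m)))

instance (m : ℕ) : Fintype (GraphClass m) := Fintype.ofFinite _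

/-- The `k`-th power sum `p_k(G)` of the roots of `f(G, x)`, counted with multiplicity. -/
def powerSum (f : GraphPolynomial) (k : ℕ) {V : Type} [Finite V] (G : SimpleGraph V) : ℂ :=
  ((f V G).roots.map (fun z => z ^ k)).sum

open Classical in
/-- `c k F` are the coefficients expressing the power sums `p_k(G)` through the numbers
`inj(F, G)` with `F` connected: `c 0 K₁ = 1`, and for `k ≥ 1`, summing over isomorphism classes
of connected graphs `F`, `p_k(G) = ∑_{2 ≤ v(F) ≤ k + 1} c_k(F) inj(F, G)` for all `G`. -/
def IsPowerSumCoeff (f : GraphPolynomial) (c : ℕ → ∀ {m : ℕ}, GraphClass m → ℂ) : Prop :=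
  (∀ F : GraphClass 1, c 0 F = 1) ∧
  ∀ k : ℕ, 1 ≤ k → ∀ (V : Type) [Finite V] (G : SimpleGraph V),
    powerSum f k G =
      ∑ m ∈ Finset.Icc 2 (k + 1), ∑ F : GraphClass m with F.rep.Connected,
        c k F * (injCount F.rep G : ℂ)

/-- For every admissible pair `(G, d)`, all roots of `f(G, x)` have absolute value `≤ C d`. -/
def IsRootBound (f : GraphPolynomial) (C : ℝ) : Prop :=
  ∀ (V : Type) [Finite V] (G : SimpleGraph V) (d : ℝ), IsAdmissible G d →
    ∀ z ∈ (f V G).roots, ‖z‖ ≤ C * d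

/-- The uniform probability measure `ν_{G,d}` on the `v(G)` points `z / d`, where `z` runs over
the roots of `f(G, x)` with multiplicity. -/
def rootMeasure (f : GraphPolynomial) {V : Type} [Finite V] (G : SimpleGraph V) (d : ℝ) :
    Measure ℂ :=
  (Nat.card V : ENNReal)⁻¹ • ((f V G).roots.map (fun z => Measure.dirac (z / (d : ℂ)))).sum

end

/-!
The polynomials of the induced subgraphs of a graph `G` are determined by the numbers
`w(S) = f'(G[S], 0)`: summing over the block `S` containing a fixed node `v`,
`f(G, x) = x ∑_{v ∈ S} w(S) f(G[V \ S], x)` (`IsBinomialFamily.eq_X_mul_sum`). Everything else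
follows from this recursion.

*Root bound.* Dividing the recursion by `f(G - v, x)` bounds the ratio `f(G, x) / f(G - v, x)` from
below by induction on the number of nodes (`IsBinomialFamily.norm_eval_insert`); the bound on
`∑ |w(S)|` makes the blocks with at least two nodes a geometric series once `|x| > 6 b d`.

*Power sums.* Let `q_k(G) = ∑_{S} (-1)^{|V \ S|} p_k(G[S])`, so that `p_k(G)` is the sum of
`q_k(G[S])` over all `S` (`powerSum_eq_sum_primPowerSum`). Additivity of `p_k` over disjoint unions
gives `q_k(G) = 0` for `G` disconnected. That `q_k(G) = 0` for more than `k + 1` nodes is a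
statement about the generating function of the `p_k`, which is the logarithmic derivative of the
reversed polynomial. A function of `A ⊆ V` with values in power series is called graded if its
Möbius transform at `T` is divisible by `X ^ |T|`. Graded functions are closed under products and
inverses (`IsGraded.mul`, `IsGraded.inv`), so the recursion shows that the ratio of the reversed
polynomials of `A ∪ {v}` and `A` is graded in `A` (`isGraded_ratio`); hence so is its logarithmic
derivative (`moebius_coeff_logDer`). Finally `q_k`, an invariant of connected graphs on at most
`k + 1` nodes, is a combination of the numbers `inj(F, G)` with `F` of the size of `G`, since these
form a triangular system with respect to the number of edges (`exists_coeff_of_invariant`).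

*Limits.* A homomorphism from a connected `F` is determined by the image of a root and, for each
other node, a choice among the at most `d` neighbours of the image of its parent (`card_hom_le`).
So `inj(F, G)` is at most `v(G) d^{v(F) - 1}` and agrees with `hom(F, G)` up to a relative error
`O(1 / d)`; in `p_k(G) / (v(G) d^k)` only the graphs with `k + 1` nodes survive (`tendsto_moment`).
All scaled roots lie in the disc of radius `C`. There harmonic functions are uniform limits of real
parts of polynomials (`exists_polynomial_re_near`), so their integrals converge, and `log |ξ - z|`
gives the normalized absolute value. For real roots the Weierstrass theorem replaces harmonicity,
and compactness of the probability measures on the disc provides the weak limit.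
-/

/-! ### Families of binomial type indexed by finite sets -/

section Binomial

variable {V : Type*} [DecidableEq V]

/-- A family of monic polynomials indexed by the finite subsets of `V`, of degree the cardinality
of the index and satisfying the binomial identity. The polynomials `f(G[A], x)` attached to the
induced subgraphs of one graph `G` form such a family. -/
structure IsBinomialFamily (Φ : Finset V → ℂ[X]) : Prop where
  monic : ∀ A, (Φ A).Monic
  natDegree_eq : ∀ A, (Φ A).natDegree = A.card
  eval_add : ∀ A x y,
    (Φ A).eval (x + y) = ∑ S ∈ A.powerset, (Φ S).eval x * (Φ (A \ S)).eval y

/-- The linear coefficient of `Φ S`, as the value of the derivative at `0`. -/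
noncomputable def linCoeff (Φ : Finset V → ℂ[X]) (S : Finset V) : ℂ :=
  (derivative (Φ S)).eval 0

namespace IsBinomialFamily

variable {Φ : Finset V → ℂ[X]}

lemma empty (hΦ : IsBinomialFamily Φ) : Φ ∅ = 1 :=
  eq_one_of_monic_natDegree_zero (hΦ.monic ∅) (by simp [hΦ.natDegree_eq])

lemma eval_zero (hΦ : IsBinomialFamily Φ) {A : Finset V} (hA : A.Nonempty) : (Φ A).eval 0 = 0 := by
  induction A using Finset.strongInduction with
  | H A ih =>
    have h := hΦ.eval_add A 0 0
    have hne : (∅ : Finset V) ≠ A := hA.ne_empty.symm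
    have hsub : ({∅, A} : Finset (Finset V)) ⊆ A.powerset := by
      intro S hS
      rcases Finset.mem_insert.mp hS with rfl | hS
      · simp
      · simp_all
    rw [← Finset.sum_subset hsub, Finset.sum_pair hne] at h
    · simp [hΦ.empty] at h
      exact h
    · intro S hS hS'
      simp only [Finset.mem_powerset, Finset.mem_insert, Finset.mem_singleton, not_or] at hS hS'
      rw [ih S (hS.ssubset_of_ne hS'.2) (Finset.nonempty_iff_ne_empty.mpr hS'.1), zero_mul]

lemma linCoeff_empty (hΦ : IsBinomialFamily Φ) : linCoeff Φ ∅ = 0 := by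
  simp [linCoeff, hΦ.empty]

lemma singleton (hΦ : IsBinomialFamily Φ) (v : V) : Φ {v} = X := by
  have h1 := (hΦ.monic {v}).eq_X_add_C (by simp [hΦ.natDegree_eq])
  have h2 := hΦ.eval_zero (Finset.singleton_nonempty v)
  rw [h1] at h2 ⊢
  simp at h2
  simp [h2]

lemma linCoeff_singleton (hΦ : IsBinomialFamily Φ) (v : V) : linCoeff Φ {v} = 1 := by
  simp [linCoeff, hΦ.singleton]

lemma derivative_eq (hΦ : IsBinomialFamily Φ) (A : Finset V) :
    derivative (Φ A) = ∑ S ∈ A.powerset, C (linCoeff Φ S) * Φ (A \ S) := by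
  refine Polynomial.funext fun y => ?_
  have h : (Φ A).comp (X + C y) = ∑ S ∈ A.powerset, Φ S * C ((Φ (A \ S)).eval y) := by
    refine Polynomial.funext fun x => ?_
    simp [eval_finsetSum, hΦ.eval_add]
  have h' := congrArg (fun p => (derivative p).eval 0) h
  simp only [derivative_comp, derivative_sum, derivative_mul, derivative_C] at h'
  simpa [eval_finsetSum, linCoeff, eval_comp] using h'

/-- Summation over the block containing a given point `v`. -/
lemma eq_X_mul_sum (hΦ : IsBinomialFamily Φ) {A : Finset V} {v : V} (hv : v ∈ A) :
    Φ A = X * ∑ S ∈ A.powerset with v ∈ S, C (linCoeff Φ S) * Φ (A \ S) := by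
  induction A using Finset.strongInduction with
  | H A ih =>
    -- Both sides vanish at `0`, so it is enough to compare derivatives.
    have hder : derivative (Φ A) =
        derivative (X * ∑ S ∈ A.powerset with v ∈ S, C (linCoeff Φ S) * Φ (A \ S)) := by
      rw [derivative_mul, derivative_X, one_mul, derivative_sum, hΦ.derivative_eq,
        ← Finset.sum_filter_add_sum_filter_not _ (fun S => v ∈ S)]
      congr 1
      have h1 : ∀ T ∈ A.powerset.filter (fun S => v ∉ S),
          C (linCoeff Φ T) * Φ (A \ T) = ∑ S ∈ (A \ T).powerset with v ∈ S,
            X * (C (linCoeff Φ S) * (C (linCoeff Φ T) * Φ ((A \ S) \ T))) := by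
        intro T hT
        simp only [Finset.mem_filter, Finset.mem_powerset] at hT
        rcases T.eq_empty_or_nonempty with rfl | hne
        · simp [hΦ.linCoeff_empty]
        · rw [ih (A \ T) (Finset.sdiff_ssubset hT.1 hne) (by simp [hv, hT.2]), Finset.mul_sum,
            Finset.mul_sum]
          refine Finset.sum_congr rfl fun S _ => ?_
          rw [sdiff_right_comm]
          ring
      rw [Finset.sum_congr rfl h1, Finset.mul_sum]
      simp only [derivative_mul, derivative_C, zero_mul, zero_add, hΦ.derivative_eq,
        Finset.mul_sum]
      refine Finset.sum_comm' fun S T => ?_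
      simp only [Finset.mem_filter, Finset.mem_powerset, Finset.subset_sdiff]
      constructor
      · rintro ⟨⟨a, b⟩, ⟨c, d⟩, e⟩
        exact ⟨⟨a, d.symm⟩, c, e⟩
      · rintro ⟨⟨a, d⟩, c, e⟩
        exact ⟨⟨a, fun h => Finset.disjoint_left.mp d h e⟩, ⟨c, d.symm⟩, e⟩
    have h0 : (Φ A).coeff 0 = (X * ∑ S ∈ A.powerset with v ∈ S,
        C (linCoeff Φ S) * Φ (A \ S)).coeff 0 := by
      rw [coeff_zero_eq_eval_zero, hΦ.eval_zero ⟨v, hv⟩, coeff_X_mul_zero]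
    have hd := Polynomial.derivative_eq_zero.mp (show derivative
      (Φ A - X * ∑ S ∈ A.powerset with v ∈ S, C (linCoeff Φ S) * Φ (A \ S)) = 0 by
        rw [derivative_sub, hder, sub_self])
    have := eq_C_of_natDegree_eq_zero hd
    rw [coeff_sub, h0, sub_self, C_0] at this
    exact sub_eq_zero.mp this

/-- If the linear coefficients of the sets of size `t` through a given point sum to at most
`β ^ (t - 1)`, then adding one point multiplies `|Φ(x)|` by at least `|x| / 2` as soon as
`|x| > 6 β`. The factor `1 / 2` is reproduced by the induction: the blocks of size `t` contribute
at most `(2 β / |x|) ^ (t - 1) ≤ (1 / 3) ^ (t - 1)` relative to the singleton block. -/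
lemma norm_eval_insert (hΦ : IsBinomialFamily Φ) {β : ℝ} {x : ℂ} (hβ : 0 ≤ β) (hx : 6 * β < ‖x‖)
    (hw : ∀ A : Finset V, ∀ v, ∀ t : ℕ, 1 ≤ t →
      ∑ S ∈ A.powerset with v ∈ S ∧ S.card = t, ‖linCoeff Φ S‖ ≤ β ^ (t - 1))
    (A : Finset V) (v : V) (hv : v ∉ A) :
    ‖x‖ / 2 * ‖(Φ A).eval x‖ ≤ ‖(Φ (insert v A)).eval x‖ := by
  have hx0 : 0 < ‖x‖ := by linarith
  induction A using Finset.strongInduction generalizing v with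
  | H A ih =>
    have hT : ∀ T ⊆ A, ‖(Φ (A \ T)).eval x‖ ≤ (2 / ‖x‖) ^ T.card * ‖(Φ A).eval x‖ := by
      intro T
      induction T using Finset.induction_on with
      | empty => simp
      | insert u T hu ihT =>
        intro hTA
        rw [Finset.insert_subset_iff] at hTA
        have h1 := ihT hTA.2
        have hne : (insert u T).Nonempty := ⟨u, by simp⟩
        have h2 := ih (A \ insert u T) (Finset.sdiff_ssubset
          (Finset.insert_subset hTA.1 hTA.2) hne) u (by simp)
        have h3 : insert u (A \ insert u T) = A \ T := by
          ext a
          by_cases ha : a = u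
          · subst ha; simp [hTA.1, hu]
          · simp [ha]
        rw [h3] at h2
        rw [Finset.card_insert_of_notMem hu, pow_succ]
        calc ‖(Φ (A \ insert u T)).eval x‖
            = 2 / ‖x‖ * (‖x‖ / 2 * ‖(Φ (A \ insert u T)).eval x‖) := by field_simp
          _ ≤ 2 / ‖x‖ * ((2 / ‖x‖) ^ T.card * ‖(Φ A).eval x‖) := by
              exact mul_le_mul_of_nonneg_left (h2.trans h1) (by positivity)
          _ = _ := by ring
    set B := insert v A with hB
    have hvB : v ∈ B := by simp [B]
    set P := B.powerset.filter (fun S => v ∈ S) with hP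
    have hmem : ({v} : Finset V) ∈ P := by simp [P, B]
    have hBv : B \ {v} = A := by
      rw [Finset.sdiff_singleton_eq_erase, Finset.erase_insert hv]
    have hrec : (Φ B).eval x = x * ((Φ A).eval x +
        ∑ S ∈ P.erase {v}, linCoeff Φ S * (Φ (B \ S)).eval x) := by
      rw [hΦ.eq_X_mul_sum hvB, ← Finset.add_sum_erase _ _ hmem]
      simp [eval_finsetSum, hΦ.linCoeff_singleton, hBv]
    have hterm : ∀ S ∈ P.erase {v}, ‖linCoeff Φ S * (Φ (B \ S)).eval x‖ ≤
        ‖linCoeff Φ S‖ * (2 / ‖x‖) ^ (S.card - 1) * ‖(Φ A).eval x‖ := by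
      intro S hS
      simp only [P, Finset.mem_erase, Finset.mem_filter, Finset.mem_powerset] at hS
      have h1 : B \ S = A \ S.erase v := by
        ext a
        by_cases ha : a = v
        · subst ha; simp [hv, hS.2.2]
        · simp [B, ha]
      have h2 := hT (S.erase v) (by
        intro a ha
        rw [Finset.mem_erase] at ha
        exact (Finset.mem_insert.mp (hS.2.1 ha.2)).resolve_left ha.1)
      rw [Finset.card_erase_of_mem hS.2.2] at h2
      rw [norm_mul, h1, mul_assoc]
      gcongr
    have hsum : ∑ S ∈ P.erase {v}, ‖linCoeff Φ S‖ * (2 / ‖x‖) ^ (S.card - 1) ≤ 1 / 2 := by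
      have hmaps : ∀ S ∈ P.erase {v}, S.card ∈ Finset.Icc 2 (B.card) := by
        intro S hS
        simp only [P, Finset.mem_erase, Finset.mem_filter, Finset.mem_powerset] at hS
        rw [Finset.mem_Icc]
        refine ⟨?_, Finset.card_le_card hS.2.1⟩
        by_contra hlt
        exact hS.1 (Finset.eq_singleton_iff_unique_mem.mpr ⟨hS.2.2, fun a ha =>
          Finset.card_le_one.mp (by omega) a ha v hS.2.2⟩)
      rw [← Finset.sum_fiberwise_of_maps_to hmaps]
      have hq : 2 * β / ‖x‖ ≤ 1 / 3 := by
        rw [div_le_div_iff₀ hx0 (by norm_num)]; linarith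
      calc ∑ t ∈ Finset.Icc 2 B.card, ∑ S ∈ P.erase {v} with S.card = t,
            ‖linCoeff Φ S‖ * (2 / ‖x‖) ^ (S.card - 1)
          ≤ ∑ t ∈ Finset.Icc 2 B.card, (1 / 3 : ℝ) ^ (t - 1) := by
            refine Finset.sum_le_sum fun t ht => ?_
            rw [Finset.mem_Icc] at ht
            calc ∑ S ∈ P.erase {v} with S.card = t, ‖linCoeff Φ S‖ * (2 / ‖x‖) ^ (S.card - 1)
                = (∑ S ∈ P.erase {v} with S.card = t, ‖linCoeff Φ S‖) * (2 / ‖x‖) ^ (t - 1) := by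
                  rw [Finset.sum_mul]
                  refine Finset.sum_congr rfl fun S hS => ?_
                  rw [(Finset.mem_filter.mp hS).2]
              _ ≤ β ^ (t - 1) * (2 / ‖x‖) ^ (t - 1) := by
                  gcongr
                  refine le_trans (Finset.sum_le_sum_of_subset_of_nonneg ?_ ?_) (hw B v t (by omega))
                  · intro S hS
                    simp only [P, Finset.mem_erase, Finset.mem_filter] at hS
                    simp [hS.1.2.2, hS.2, Finset.mem_powerset.mp hS.1.2.1]
                  · intros; positivity
              _ = (2 * β / ‖x‖) ^ (t - 1) := by rw [← mul_pow]; congr 1; ring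
              _ ≤ _ := by gcongr
        _ = ∑ s ∈ Finset.Icc 1 (B.card - 1), (1 / 3 : ℝ) ^ s := by
            refine Finset.sum_nbij' (fun t => t - 1) (fun s => s + 1) ?_ ?_ ?_ ?_ ?_ <;>
              intro a ha <;> simp only [Finset.mem_Icc] at ha ⊢ <;> omega
        _ ≤ 1 / 2 := by
            have : ∀ n : ℕ, ∑ s ∈ Finset.Icc 1 n, (1 / 3 : ℝ) ^ s = 1 / 2 - 1 / 2 * (1 / 3) ^ n := by
              intro n
              induction n with
              | zero => simp
              | succ n ihn => rw [Finset.sum_Icc_succ_top (by omega), ihn]; ring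
            rw [this]
            have : (0 : ℝ) ≤ 1 / 2 * (1 / 3) ^ (B.card - 1) := by positivity
            linarith
    have hrest : ‖∑ S ∈ P.erase {v}, linCoeff Φ S * (Φ (B \ S)).eval x‖ ≤
        1 / 2 * ‖(Φ A).eval x‖ := by
      refine (norm_sum_le_of_le _ hterm).trans ?_
      rw [← Finset.sum_mul]
      gcongr
    rw [hrec, norm_mul, div_mul_eq_mul_div, mul_div_assoc]
    gcongr
    have := norm_sub_le_norm_add ((Φ A).eval x)
      (∑ S ∈ P.erase {v}, linCoeff Φ S * (Φ (B \ S)).eval x)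
    linarith

/-- Zero-freeness outside the disc of radius `6 β`. -/
lemma eval_ne_zero (hΦ : IsBinomialFamily Φ) {β : ℝ} {x : ℂ} (hβ : 0 ≤ β) (hx : 6 * β < ‖x‖)
    (hw : ∀ A : Finset V, ∀ v, ∀ t : ℕ, 1 ≤ t →
      ∑ S ∈ A.powerset with v ∈ S ∧ S.card = t, ‖linCoeff Φ S‖ ≤ β ^ (t - 1))
    (A : Finset V) : (Φ A).eval x ≠ 0 := by
  induction A using Finset.induction_on with
  | empty => simp [hΦ.empty]
  | insert v A hv ih =>
    have h := hΦ.norm_eval_insert hβ hx hw A v hv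
    have hx0 : 0 < ‖x‖ := by linarith
    have : 0 < ‖(Φ A).eval x‖ := norm_pos_iff.mpr ih
    exact norm_pos_iff.mp (lt_of_lt_of_le (by positivity) h)

end IsBinomialFamily
end Binomial

/-! ### Möbius transforms of set functions -/

section Moebius

variable {V : Type*} {R : Type*} [CommRing R]

/-- The Möbius transform of a set function: the alternating sum over all subsets. -/
def moebius (h : Finset V → R) (B : Finset V) : R :=
  ∑ T ∈ B.powerset, (-1) ^ (B.card + T.card) * h T

lemma moebius_sub (h g : Finset V → R) (B : Finset V) :
    moebius (fun A => h A - g A) B = moebius h B - moebius g B := by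
  simp only [moebius, mul_sub, Finset.sum_sub_distrib]

lemma moebius_congr {h g : Finset V → R} {B : Finset V} (H : ∀ A ⊆ B, h A = g A) :
    moebius h B = moebius g B :=
  Finset.sum_congr rfl fun T hT => by rw [H T (Finset.mem_powerset.mp hT)]

variable [DecidableEq V]

lemma moebius_insert (h : Finset V → R) {v : V} {B : Finset V} (hv : v ∉ B) :
    moebius h (insert v B) = moebius (fun A => h (insert v A) - h A) B := by
  rw [moebius, Finset.sum_powerset_insert hv, moebius, ← Finset.sum_add_distrib]
  refine Finset.sum_congr rfl fun T hT => ?_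
  have hvT : v ∉ T := fun h => hv (Finset.mem_powerset.mp hT h)
  rw [Finset.card_insert_of_notMem hv, Finset.card_insert_of_notMem hvT]
  ring

/-- Möbius inversion. -/
lemma sum_moebius (h : Finset V → R) (A : Finset V) :
    ∑ B ∈ A.powerset, moebius h B = h A := by
  induction A using Finset.induction_on generalizing h with
  | empty => simp [moebius]
  | insert v A hv ih =>
    rw [Finset.sum_powerset_insert hv, ih, Finset.sum_congr rfl
      (fun B hB => moebius_insert h (B := B) (fun h => hv (Finset.mem_powerset.mp hB h))), ih]
    ring

lemma moebius_eq_of_sum {h a : Finset V → R} {B : Finset V}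
    (H : ∀ A ⊆ B, h A = ∑ T ∈ A.powerset, a T) : moebius h B = a B := by
  induction B using Finset.induction_on generalizing h a with
  | empty => simpa [moebius] using H ∅ le_rfl
  | insert v B hv ih =>
    rw [moebius_insert h hv]
    refine ih (a := fun T => a (insert v T)) fun A hA => ?_
    have hvA : v ∉ A := fun h => hv (hA h)
    rw [H _ (Finset.insert_subset_insert v hA), H A (hA.trans (Finset.subset_insert v B)),
      Finset.sum_powerset_insert hvA]
    ring

/-- A set function that does not depend on the presence of a point of `B` has vanishing Möbius
transform at `B`. -/
lemma moebius_eq_zero_of_insert {h : Finset V → R} {v : V} {B : Finset V} (hv : v ∈ B)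
    (H : ∀ A ⊆ B, h (insert v A) = h A) : moebius h B = 0 := by
  rw [← Finset.insert_erase hv, moebius_insert h (Finset.notMem_erase v B)]
  refine Finset.sum_eq_zero fun T hT => ?_
  have hTB : T ⊆ B := (Finset.mem_powerset.mp hT).trans (Finset.erase_subset v B)
  simp only [H T hTB, sub_self, mul_zero]

end Moebius

/-! ### Set functions with graded Möbius transform -/

section Graded

open PowerSeries

variable {V : Type*}

/-- A power-series-valued function on the subsets of `U` is graded if the value of its Möbius
transform at `T` is divisible by `X ^ |T|`, for all `T ⊆ U`. -/
def IsGraded (U : Finset V) (h : Finset V → ℂ⟦X⟧) : Prop :=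
  ∃ a : Finset V → ℂ⟦X⟧, ∀ A ⊆ U, h A = ∑ T ∈ A.powerset, (PowerSeries.X : ℂ⟦X⟧) ^ T.card * a T

namespace IsGraded

variable {U : Finset V} {h g : Finset V → ℂ⟦X⟧}

lemma congr (hh : IsGraded U h) (H : ∀ A ⊆ U, g A = h A) : IsGraded U g := by
  obtain ⟨a, ha⟩ := hh
  exact ⟨a, fun A hA => (H A hA).trans (ha A hA)⟩

lemma mono {W : Finset V} (hh : IsGraded U h) (hW : W ⊆ U) : IsGraded W h := by
  obtain ⟨a, ha⟩ := hh
  exact ⟨a, fun A hA => ha A (hA.trans hW)⟩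

lemma add (hh : IsGraded U h) (hg : IsGraded U g) : IsGraded U fun A => h A + g A := by
  obtain ⟨a, ha⟩ := hh
  obtain ⟨b, hb⟩ := hg
  refine ⟨fun T => a T + b T, fun A hA => ?_⟩
  simp only [ha A hA, hb A hA, mul_add, Finset.sum_add_distrib]

lemma const_mul (c : ℂ⟦X⟧) (hh : IsGraded U h) : IsGraded U fun A => c * h A := by
  obtain ⟨a, ha⟩ := hh
  refine ⟨fun T => c * a T, fun A hA => ?_⟩
  simp only [ha A hA, Finset.mul_sum, mul_left_comm]

lemma X_mul_derivative (hh : IsGraded U h) : IsGraded U fun A => PowerSeries.X * d⁄dX ℂ (h A) := by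
  obtain ⟨a, ha⟩ := hh
  refine ⟨fun T => (T.card : ℂ⟦X⟧) * a T + PowerSeries.X * d⁄dX ℂ (a T), fun A hA => ?_⟩
  simp only [ha A hA, map_sum, Finset.mul_sum]
  refine Finset.sum_congr rfl fun T _ => ?_
  rw [Derivation.leibniz, PowerSeries.derivative_pow, PowerSeries.derivative_X]
  simp only [smul_eq_mul]
  rcases Nat.eq_zero_or_pos T.card with h0 | h0
  · simp [h0]
  · obtain ⟨n, hn⟩ := Nat.exists_eq_succ_of_ne_zero h0.ne'
    rw [hn]
    simp only [Nat.succ_eq_add_one, Nat.add_sub_cancel]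
    ring

variable [DecidableEq V]

lemma const (U : Finset V) (c : ℂ⟦X⟧) : IsGraded U fun _ => c := by
  refine ⟨fun T => if T = ∅ then c else 0, fun A _ => ?_⟩
  simp [mul_ite, Finset.sum_ite_eq']

lemma sum {ι : Type*} {s : Finset ι} {h : ι → Finset V → ℂ⟦X⟧}
    (hh : ∀ i ∈ s, IsGraded U (h i)) : IsGraded U fun A => ∑ i ∈ s, h i A := by
  classical
  induction s using Finset.induction_on with
  | empty => simpa using const U 0
  | insert i s hi ih =>
    simp only [Finset.sum_insert hi]
    exact (hh i (by simp)).add (ih fun j hj => hh j (by simp [hj]))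

/-- Gradedness on `insert v U` through the difference quotient at `v`. -/
lemma insert_iff {v : V} (hv : v ∉ U) :
    IsGraded (insert v U) h ↔ IsGraded U h ∧
      ∃ h', IsGraded U h' ∧ ∀ A ⊆ U, h (insert v A) = h A + PowerSeries.X * h' A := by
  constructor
  · rintro ⟨a, ha⟩
    refine ⟨⟨a, fun A hA => ha A (hA.trans (Finset.subset_insert v U))⟩,
      fun A => ∑ T ∈ A.powerset, PowerSeries.X ^ T.card * a (insert v T),
      ⟨_, fun A _ => rfl⟩, fun A hA => ?_⟩
    have hvA : v ∉ A := fun h => hv (hA h)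
    rw [ha _ (Finset.insert_subset_insert v hA), Finset.sum_powerset_insert hvA,
      ha A (hA.trans (Finset.subset_insert v U)), Finset.mul_sum]
    congr 1
    refine Finset.sum_congr rfl fun T hT => ?_
    rw [Finset.card_insert_of_notMem fun h => hvA (Finset.mem_powerset.mp hT h)]
    ring
  · rintro ⟨⟨a, ha⟩, h', ⟨b, hb⟩, H⟩
    refine ⟨fun T => if v ∈ T then b (T.erase v) else a T, fun A hA => ?_⟩
    have key : ∀ B ⊆ U, h B = ∑ T ∈ B.powerset,
        PowerSeries.X ^ T.card * (if v ∈ T then b (T.erase v) else a T) := by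
      intro B hB
      rw [ha B hB]
      refine Finset.sum_congr rfl fun T hT => ?_
      rw [if_neg fun h => hv (hB (Finset.mem_powerset.mp hT h))]
    by_cases hvA : v ∈ A
    · have hB : A.erase v ⊆ U := by
        rw [← Finset.erase_insert hv]; exact Finset.erase_subset_erase v hA
      have hvB : v ∉ A.erase v := Finset.notMem_erase v A
      rw [← Finset.insert_erase hvA, H _ hB, Finset.sum_powerset_insert hvB, key _ hB, hb _ hB,
        Finset.mul_sum]
      congr 1
      refine Finset.sum_congr rfl fun T hT => ?_
      have hvT : v ∉ T := fun h => hvB (Finset.mem_powerset.mp hT h)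
      simp only [Finset.card_insert_of_notMem hvT, if_pos (Finset.mem_insert_self v T),
        Finset.erase_insert hvT]
      ring
    · exact key A ((Finset.subset_insert_iff_of_notMem hvA).mp hA)

lemma mul (hh : IsGraded U h) (hg : IsGraded U g) : IsGraded U fun A => h A * g A := by
  induction U using Finset.induction_on generalizing h g with
  | empty => exact (const ∅ (h ∅ * g ∅)).congr fun A hA => by rw [Finset.subset_empty.mp hA]
  | insert v U hv ih =>
    obtain ⟨h1, h', h2, hH⟩ := (insert_iff hv).mp hh
    obtain ⟨g1, g', g2, hG⟩ := (insert_iff hv).mp hg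
    refine (insert_iff hv).mpr ⟨ih h1 g1,
      fun A => (h A * g' A + h' A * g A) + PowerSeries.X * (h' A * g' A),
      ((ih h1 g2).add (ih h2 g1)).add ((ih h2 g2).const_mul PowerSeries.X), fun A hA => ?_⟩
    rw [hH A hA, hG A hA]
    ring

lemma comp_insert {v : V} (hv : v ∉ U) (hh : IsGraded (insert v U) h) :
    IsGraded U fun A => h (insert v A) := by
  obtain ⟨h1, h', h2, hH⟩ := (insert_iff hv).mp hh
  exact (h1.add (h2.const_mul PowerSeries.X)).congr hH

lemma comp_union {T : Finset V} (hT : Disjoint U T) (hh : IsGraded (U ∪ T) h) :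
    IsGraded U fun A => h (A ∪ T) := by
  induction T using Finset.induction_on generalizing U with
  | empty => simpa using hh
  | insert v T hv ih =>
    rw [Finset.disjoint_insert_right] at hT
    have h1 : IsGraded (insert v U) fun A => h (A ∪ T) := by
      refine ih (Finset.disjoint_insert_left.mpr ⟨hv, hT.2⟩) ?_
      rwa [Finset.insert_union, ← Finset.union_insert]
    refine (comp_insert hT.1 h1).congr fun A _ => ?_
    rw [Finset.insert_union, Finset.union_insert]

lemma inv (hh : IsGraded U h) (h0 : ∀ A, constantCoeff (h A) ≠ 0) :
    IsGraded U fun A => (h A)⁻¹ := by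
  induction U using Finset.induction_on generalizing h with
  | empty => exact (const ∅ (h ∅)⁻¹).congr fun A hA => by rw [Finset.subset_empty.mp hA]
  | insert v U hv ih =>
    obtain ⟨h1, h', h2, hH⟩ := (insert_iff hv).mp hh
    have h3 := ih (comp_insert hv hh) fun A => h0 _
    refine (insert_iff hv).mpr ⟨ih h1 h0, fun A => -1 * (h' A * ((h A)⁻¹ * (h (insert v A))⁻¹)),
      (h2.mul ((ih h1 h0).mul h3)).const_mul _, fun A hA => ?_⟩
    have e1 := PowerSeries.mul_inv_cancel (h A) (h0 A)
    have e2 := PowerSeries.mul_inv_cancel (h (insert v A)) (h0 _)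
    have e3 := hH A hA
    linear_combination (-(h A)⁻¹ * (h (insert v A))⁻¹) * e3 + (-(h (insert v A))⁻¹) * e1
      + (h A)⁻¹ * e2

/-- The contribution of a fixed block `T`: its factor `X ^ |T|` pays for the presence of `T`. -/
lemma block {T : Finset V} {k : Finset V → ℂ⟦X⟧} (hk : IsGraded (U \ T) k) :
    IsGraded U fun A => if T ⊆ A then PowerSeries.X ^ T.card * k (A \ T) else 0 := by
  obtain ⟨a, ha⟩ := hk
  refine ⟨fun S => if T ⊆ S then a (S \ T) else 0, fun A hA => ?_⟩
  by_cases hTA : T ⊆ A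
  · simp only [if_pos hTA, mul_ite, mul_zero]
    rw [ha _ (Finset.sdiff_subset_sdiff hA le_rfl), Finset.mul_sum, ← Finset.sum_filter]
    refine Finset.sum_bij' (fun S _ => S ∪ T) (fun S _ => S \ T) ?_ ?_ ?_ ?_ ?_
    · intro S hS
      simp only [Finset.mem_powerset, Finset.subset_sdiff, Finset.mem_filter] at hS ⊢
      exact ⟨Finset.union_subset hS.1 hTA, Finset.subset_union_right⟩
    · intro S hS
      simp only [Finset.mem_powerset, Finset.mem_filter] at hS ⊢
      exact Finset.sdiff_subset_sdiff hS.1 le_rfl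
    · intro S hS
      simp only [Finset.mem_powerset, Finset.subset_sdiff] at hS
      exact Finset.union_sdiff_cancel_right hS.2
    · intro S hS
      simp only [Finset.mem_filter] at hS
      exact Finset.sdiff_union_of_subset hS.2
    · intro S hS
      simp only [Finset.mem_powerset, Finset.subset_sdiff] at hS
      rw [Finset.union_sdiff_cancel_right hS.2, Finset.card_union_of_disjoint hS.2]
      ring
  · simp only [if_neg hTA]
    refine (Finset.sum_eq_zero fun S hS => ?_).symm
    rw [if_neg fun h => hTA (h.trans (Finset.mem_powerset.mp hS)), mul_zero]

end IsGraded

/-- The logarithmic derivative `X F' / F` of a power series. -/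
noncomputable def logDer (F : ℂ⟦X⟧) : ℂ⟦X⟧ := PowerSeries.X * d⁄dX ℂ F * F⁻¹

lemma logDer_mul {F G : ℂ⟦X⟧} (hF : constantCoeff F ≠ 0) (hG : constantCoeff G ≠ 0) :
    logDer (F * G) = logDer F + logDer G := by
  have e1 := PowerSeries.mul_inv_cancel F hF
  have e2 := PowerSeries.mul_inv_cancel G hG
  simp only [logDer, Derivation.leibniz, PowerSeries.mul_inv_rev, smul_eq_mul]
  linear_combination (PowerSeries.X * d⁄dX ℂ G * G⁻¹) * e1 + (PowerSeries.X * d⁄dX ℂ F * F⁻¹) * e2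

lemma logDer_one_sub (z : ℂ) :
    logDer (1 - PowerSeries.C z * PowerSeries.X) = 1 - mk fun k => z ^ k := by
  have h : (1 - PowerSeries.C z * PowerSeries.X) * (mk fun k => z ^ k) = 1 := by
    have := congrArg (rescale z) (mk_one_mul_one_sub_eq_one ℂ)
    simp only [map_mul, map_sub, map_one, rescale_X] at this
    have hm : (mk fun k => z ^ k) = rescale z (mk 1) := by
      ext n
      simp [coeff_rescale]
    rw [mul_comm, hm, this]
  have hc : PowerSeries.constantCoeff (1 - PowerSeries.C z * PowerSeries.X) ≠ 0 := by simp
  have hi : (1 - PowerSeries.C z * PowerSeries.X : ℂ⟦X⟧)⁻¹ = mk fun k => z ^ k := by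
    rw [PowerSeries.inv_eq_iff_mul_eq_one hc, mul_comm]; exact h
  rw [logDer, hi]
  simp only [map_sub, Derivation.leibniz, PowerSeries.derivative_C, PowerSeries.derivative_X,
    PowerSeries.derivative_one, smul_eq_mul]
  linear_combination h

section Recursion

variable [DecidableEq V] {F : Finset V → ℂ⟦X⟧} {w : Finset V → ℂ}

/-- If `F` satisfies the recursion over the block of a point, the ratios `F(A ∪ v) / F(A)` are
graded. The recursion expresses such a ratio through products of inverses of ratios on smaller
ground sets. -/
lemma isGraded_ratio (h1 : ∀ A, constantCoeff (F A) = 1)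
    (hrec : ∀ A v, v ∈ A → F A = ∑ S ∈ A.powerset with v ∈ S,
      PowerSeries.C (w S) * PowerSeries.X ^ (S.card - 1) * F (A \ S))
    (U : Finset V) (v : V) (hv : v ∉ U) : IsGraded U fun A => F (insert v A) * (F A)⁻¹ := by
  have h0 : ∀ A, constantCoeff (F A) ≠ 0 := fun A => by rw [h1]; exact one_ne_zero
  induction U using Finset.strongInduction generalizing v with
  | H U ih =>
    have hT : ∀ T ⊆ U, IsGraded (U \ T) fun A => F A * (F (A ∪ T))⁻¹ := by
      intro T
      induction T using Finset.induction_on with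
      | empty =>
        intro _
        exact (IsGraded.const _ 1).congr fun A _ => by
          rw [Finset.union_empty, PowerSeries.mul_inv_cancel _ (h0 A)]
      | insert u T hu ihT =>
        intro hTU
        rw [Finset.insert_subset_iff] at hTU
        have g1 := (ihT hTU.2).mono
          (Finset.sdiff_subset_sdiff (le_refl U) (Finset.subset_insert u T))
        have g2 := ih (U.erase u) (Finset.erase_ssubset hTU.1) u (Finset.notMem_erase u U)
        have hU : U.erase u = (U \ insert u T) ∪ T := by
          ext a
          by_cases ha : a = u
          · subst ha; simp [hu]
          · by_cases haT : a ∈ T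
            · simp [ha, haT, hTU.2 haT]
            · simp [ha, haT]
        rw [hU] at g2
        have g3 := (g2.comp_union (Finset.disjoint_left.mpr fun a ha haT =>
          (Finset.mem_sdiff.mp ha).2 (Finset.mem_insert_of_mem haT))).inv (by simp [h1])
        refine (g1.mul g3).congr fun A _ => ?_
        have e1 := PowerSeries.mul_inv_cancel _ (h0 (A ∪ T))
        have e3 : (F (A ∪ T))⁻¹⁻¹ = F (A ∪ T) := by
          rw [PowerSeries.inv_eq_iff_mul_eq_one (by simp [h1])]; exact e1
        rw [Finset.union_insert, PowerSeries.mul_inv_rev, e3]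
        linear_combination (-(F A) * (F (insert u (A ∪ T)))⁻¹) * e1
    have hsum : IsGraded U fun A => ∑ T ∈ U.powerset, if T ⊆ A then
        PowerSeries.X ^ T.card * (PowerSeries.C (w (insert v T)) *
          (F (A \ T) * (F (A \ T ∪ T))⁻¹)) else 0 :=
      by
      refine IsGraded.sum fun T hTU => ?_
      have h2 := (hT T (Finset.mem_powerset.mp hTU)).const_mul (PowerSeries.C (w (insert v T)))
      refine (IsGraded.block h2).congr fun A _ => ?_
      by_cases hTA : T ⊆ A
      · simp only [if_pos hTA]
      · simp only [if_neg hTA]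
    refine hsum.congr fun A hA => ?_
    have hvA : v ∉ A := fun h => hv (hA h)
    have hL : F (insert v A) = ∑ T ∈ A.powerset,
        PowerSeries.C (w (insert v T)) * PowerSeries.X ^ T.card * F (A \ T) := by
      rw [hrec (insert v A) v (Finset.mem_insert_self v A), Finset.sum_filter,
        Finset.sum_powerset_insert hvA, Finset.sum_eq_zero, zero_add]
      · refine Finset.sum_congr rfl fun T hTA => ?_
        have hvT : v ∉ T := fun h => hvA (Finset.mem_powerset.mp hTA h)
        have e : insert v A \ insert v T = A \ T := by
          ext a
          by_cases ha : a = v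
          · subst ha; simp [hvA]
          · simp [ha]
        rw [if_pos (Finset.mem_insert_self v T), Finset.card_insert_of_notMem hvT, e,
          Nat.add_sub_cancel]
      · intro T hTA
        rw [if_neg fun h => hvA (Finset.mem_powerset.mp hTA h)]
    have hU : U.powerset.filter (fun T => T ⊆ A) = A.powerset := by
      ext T
      simp only [Finset.mem_powerset, Finset.mem_filter]
      exact ⟨fun h => h.2, fun h => ⟨h.trans hA, h⟩⟩
    rw [hL, ← Finset.sum_filter, hU, Finset.sum_mul]
    refine Finset.sum_congr rfl fun T hTA => ?_
    rw [Finset.sdiff_union_of_subset (Finset.mem_powerset.mp hTA)]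
    ring

/-- The Möbius transform of the coefficients of the logarithmic derivative vanishes on sets with
more than `k + 1` elements. -/
lemma moebius_coeff_logDer (h1 : ∀ A, constantCoeff (F A) = 1)
    (hrec : ∀ A v, v ∈ A → F A = ∑ S ∈ A.powerset with v ∈ S,
      PowerSeries.C (w S) * PowerSeries.X ^ (S.card - 1) * F (A \ S))
    {k : ℕ} {B : Finset V} (hB : k + 1 < B.card) :
    moebius (fun A => coeff k (logDer (F A))) B = 0 := by
  obtain ⟨v, hv⟩ : B.Nonempty := Finset.card_pos.mp (by omega)
  have h0 : ∀ A, constantCoeff (F A) ≠ 0 := fun A => by rw [h1]; exact one_ne_zero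
  have hr := isGraded_ratio h1 hrec (B.erase v) v (Finset.notMem_erase v B)
  obtain ⟨a, ha⟩ := hr.X_mul_derivative.mul (hr.inv (by simp [h1]))
  rw [← Finset.insert_erase hv, moebius_insert _ (Finset.notMem_erase v B),
    moebius_eq_of_sum (a := fun T => coeff k (PowerSeries.X ^ T.card * a T))]
  · rw [PowerSeries.coeff_X_pow_mul', if_neg]
    rw [Finset.card_erase_of_mem hv]
    omega
  · intro A hA
    have h2 := ha A hA
    rw [← map_sum, ← h2, ← map_sub]
    congr 1
    have h3 := logDer_mul (F := F (insert v A) * (F A)⁻¹) (G := F A) (by simp [h1]) (h0 A)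
    rw [mul_assoc, PowerSeries.inv_mul_cancel _ (h0 A), mul_one] at h3
    rw [h3, add_sub_cancel_right, logDer]

end Recursion

end Graded

/-! ### Power sums of roots through the reversed polynomial -/

lemma coeff_logDer_reverse_prod (s : Multiset ℂ) :
    PowerSeries.constantCoeff
      (((s.map fun z => X - C z).prod.reverse : ℂ[X]) : PowerSeries ℂ) = 1 ∧
    ∀ k, 1 ≤ k → PowerSeries.coeff k
      (logDer (((s.map fun z => X - C z).prod.reverse : ℂ[X]) : PowerSeries ℂ)) =
        -(s.map fun z => z ^ k).sum := by
  induction s using Multiset.induction_on with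
  | empty =>
    have h1 : (1 : ℂ[X]).reverse = 1 := by rw [← C_1, reverse_C]
    have h2 : logDer 1 = 0 := by rw [logDer, PowerSeries.derivative_one, mul_zero, zero_mul]
    simp [h1, h2]
  | cons z s ih =>
    have hz : (X - C z).reverse = 1 - C z * X := by
      rw [reverse, natDegree_X_sub_C, reflect_sub, reflect_one_X, reflect_C, pow_one]
    have hcoe : ((1 - C z * X : ℂ[X]) : PowerSeries ℂ) = 1 - PowerSeries.C z * PowerSeries.X := by
      simp
    rw [Multiset.map_cons, Multiset.prod_cons, reverse_mul_of_domain, hz, coe_mul, hcoe]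
    refine ⟨by simp [ih.1], fun k hk => ?_⟩
    rw [logDer_mul (by simp) (by rw [ih.1]; exact one_ne_zero), map_add, ih.2 k hk,
      logDer_one_sub, Multiset.map_cons, Multiset.sum_cons, map_sub, PowerSeries.coeff_mk,
      PowerSeries.coeff_one, if_neg (by omega)]
    ring

/-- The power sums of the roots of a monic polynomial are, up to sign, the coefficients of the
logarithmic derivative of the reversed polynomial. -/
lemma coeff_logDer_reverse {p : ℂ[X]} (hp : p.Monic) {k : ℕ} (hk : 1 ≤ k) :
    PowerSeries.coeff k (logDer (p.reverse : PowerSeries ℂ)) =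
      -(p.roots.map fun z => z ^ k).sum := by
  have h := (coeff_logDer_reverse_prod p.roots).2 k hk
  rwa [← (IsAlgClosed.splits p).eq_prod_roots_of_monic hp] at h

namespace IsBinomialFamily

variable {V : Type*} [DecidableEq V] {Φ : Finset V → ℂ[X]}

lemma reverse_rec (hΦ : IsBinomialFamily Φ) (A : Finset V) (v : V) (hv : v ∈ A) :
    ((Φ A).reverse : PowerSeries ℂ) = ∑ S ∈ A.powerset with v ∈ S,
      PowerSeries.C (linCoeff Φ S) * PowerSeries.X ^ (S.card - 1) *
        ((Φ (A \ S)).reverse : PowerSeries ℂ) := by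
  have hsum : ∀ (s : Finset (Finset V)) (g : Finset V → ℂ[X]) (n : ℕ),
      reflect n (∑ S ∈ s, g S) = ∑ S ∈ s, reflect n (g S) := by
    intro s g n
    induction s using Finset.induction_on with
    | empty => simp
    | insert a s ha ih => rw [Finset.sum_insert ha, Finset.sum_insert ha, reflect_add, ih]
  have h : (Φ A).reverse = ∑ S ∈ A.powerset with v ∈ S,
      C (linCoeff Φ S) * X ^ (S.card - 1) * (Φ (A \ S)).reverse := by
    rw [reverse, hΦ.natDegree_eq]
    conv_lhs => rw [hΦ.eq_X_mul_sum hv, Finset.mul_sum]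
    rw [hsum]
    refine Finset.sum_congr rfl fun S hS => ?_
    simp only [Finset.mem_filter, Finset.mem_powerset] at hS
    have hc : 1 ≤ S.card := Finset.card_pos.mpr ⟨v, hS.2⟩
    have hcard : A.card = S.card + (A \ S).card := by
      rw [Finset.card_sdiff_of_subset hS.1]
      have := Finset.card_le_card hS.1
      omega
    have e : X * (C (linCoeff Φ S) * Φ (A \ S)) = C (linCoeff Φ S) * X ^ 1 * Φ (A \ S) := by ring
    rw [e, hcard, reflect_mul _ _ ((natDegree_C_mul_X_pow_le _ _).trans hc)
      (hΦ.natDegree_eq _).le, reflect_C_mul_X_pow, revAt_le hc, reverse, hΦ.natDegree_eq]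
  rw [h, ← coeToPowerSeries.ringHom_apply, map_sum]
  simp

lemma moebius_powerSum (hΦ : IsBinomialFamily Φ) {k : ℕ} (hk : 1 ≤ k) {B : Finset V}
    (hB : k + 1 < B.card) :
    moebius (fun A => ((Φ A).roots.map fun z => z ^ k).sum) B = 0 := by
  have h := moebius_coeff_logDer (F := fun A => ((Φ A).reverse : PowerSeries ℂ))
    (w := linCoeff Φ) (fun A => by
      rw [← PowerSeries.coeff_zero_eq_constantCoeff_apply, coeff_coe, coeff_zero_reverse]
      exact hΦ.monic A) hΦ.reverse_rec hB
  simp only [coeff_logDer_reverse (hΦ.monic _) hk] at h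
  simpa [moebius] using h

end IsBinomialFamily

/-! ### Graph polynomials on induced subgraphs -/

section Induced

lemma nonempty_induce_iso_image {U V : Type} {G : SimpleGraph U} {H : SimpleGraph V} (e : G ↪g H)
    {s : Set U} {t : Set V} (h : t = e '' s) : Nonempty (G.induce s ≃g H.induce t) := by
  subst h
  exact ⟨⟨Equiv.Set.image e s e.injective, by simp⟩⟩

lemma nonempty_induce_induce_iso {V : Type} (G : SimpleGraph V) {s t : Set V} {u : Set s}
    (h : t = Subtype.val '' u) : Nonempty ((G.induce s).induce u ≃g G.induce t) :=
  nonempty_induce_iso_image (SimpleGraph.Embedding.induce s) h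

variable {f : GraphPolynomial} {V : Type}

/-- The family of the polynomials of the induced subgraphs of `G`. -/
noncomputable def inducedPoly (f : GraphPolynomial) (G : SimpleGraph V) (A : Finset V) : ℂ[X] :=
  f _ (G.induce (A : Set V))

variable [DecidableEq V]

lemma isBinomialFamily_inducedPoly (hf : IsLinearlyBoundedExpType f) (G : SimpleGraph V) :
    IsBinomialFamily (inducedPoly f G) where
  monic A := hf.monic _ _
  natDegree_eq A := by simp [inducedPoly, hf.natDegree_eq]
  eval_add A x y := by
    rw [inducedPoly, hf.exponential]
    refine Finset.sum_bij' (fun S _ => S.map (Function.Embedding.subtype _))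
      (fun T _ => T.subtype (· ∈ A)) ?_ ?_ ?_ ?_ ?_
    · intro S _
      rw [Finset.mem_powerset]
      intro a ha
      obtain ⟨b, -, rfl⟩ := Finset.mem_map.mp ha
      exact b.2
    · simp
    · intro S _
      ext a
      simp
    · intro T hT
      ext a
      simpa using fun ha => Finset.mem_powerset.mp hT ha
    · intro S _
      congr 2
      · refine hf.iso_inv _ _ _ _ (nonempty_induce_induce_iso G ?_)
        simp
      · refine hf.iso_inv _ _ _ _ (nonempty_induce_induce_iso G ?_)
        ext a
        simpa using ⟨fun ⟨h, h'⟩ => ⟨h, h' h⟩, fun ⟨h, h'⟩ => ⟨h, fun _ => h'⟩⟩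

end Induced

section PowerSum

variable {f : GraphPolynomial}

lemma powerSum_congr (hf : IsLinearlyBoundedExpType f) (k : ℕ) {V W : Type} [Finite V] [Finite W]
    {G : SimpleGraph V} {H : SimpleGraph W} (e : Nonempty (G ≃g H)) :
    powerSum f k G = powerSum f k H := by
  rw [powerSum, powerSum, hf.iso_inv _ _ _ _ e]

lemma powerSum_sum (hf : IsLinearlyBoundedExpType f) (k : ℕ) {V W : Type} [Finite V] [Finite W]
    (G : SimpleGraph V) (H : SimpleGraph W) :
    powerSum f k (G ⊕g H) = powerSum f k G + powerSum f k H := by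
  rw [powerSum, powerSum, powerSum, hf.multiplicative, roots_mul
    ((hf.monic _ _).mul (hf.monic _ _)).ne_zero, Multiset.map_add, Multiset.sum_add]

/-- The power sums of the induced subgraphs of `G`, as a set function. -/
noncomputable def inducedPowerSum (f : GraphPolynomial) (k : ℕ) {V : Type} (G : SimpleGraph V)
    (A : Finset V) : ℂ :=
  powerSum f k (G.induce (A : Set V))

/-- The connected part of the power sum: the Möbius transform of `p_k` over induced subgraphs. -/
noncomputable def primPowerSum (f : GraphPolynomial) (k : ℕ) {V : Type} [Fintype V]
    (G : SimpleGraph V) : ℂ :=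
  moebius (inducedPowerSum f k G) Finset.univ

lemma moebius_map {U V R : Type*} [CommRing R] (e : U ↪ V) (h : Finset V → R) (S : Finset U) :
    moebius h (S.map e) = moebius (fun A => h (A.map e)) S := by
  classical
  induction S using Finset.induction_on generalizing h with
  | empty => simp [moebius]
  | insert v S hv ih =>
    rw [Finset.map_insert, moebius_insert _ (by simpa using hv), moebius_insert _ hv, ih]
    simp only [Finset.map_insert]

lemma moebius_inducedPowerSum_map (hf : IsLinearlyBoundedExpType f) (k : ℕ) {U V : Type}
    {G : SimpleGraph U} {H : SimpleGraph V} (e : G ↪g H) (S : Finset U) :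
    moebius (inducedPowerSum f k H) (S.map e.toEmbedding) = moebius (inducedPowerSum f k G) S := by
  rw [moebius_map]
  refine moebius_congr fun A _ => (powerSum_congr hf k (nonempty_induce_iso_image e ?_)).symm
  simp

lemma primPowerSum_congr (hf : IsLinearlyBoundedExpType f) (k : ℕ) {U V : Type} [Fintype U]
    [Fintype V] {G : SimpleGraph U} {H : SimpleGraph V} (e : G ≃g H) :
    primPowerSum f k G = primPowerSum f k H := by
  rw [primPowerSum, primPowerSum, ← moebius_inducedPowerSum_map hf k e.toEmbedding]
  congr 1
  exact (Finset.map_univ_equiv e.toEquiv)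

lemma primPowerSum_induce (hf : IsLinearlyBoundedExpType f) (k : ℕ) {V : Type}
    (G : SimpleGraph V) (S : Finset V) :
    primPowerSum f k (G.induce (S : Set V)) = moebius (inducedPowerSum f k G) S := by
  rw [primPowerSum, ← moebius_inducedPowerSum_map hf k (SimpleGraph.Embedding.induce (S : Set V))]
  congr 1
  ext a
  simp

lemma powerSum_eq_sum_primPowerSum (hf : IsLinearlyBoundedExpType f) (k : ℕ) {V : Type}
    [Fintype V] (G : SimpleGraph V) :
    powerSum f k G = ∑ S : Finset V, primPowerSum f k (G.induce (S : Set V)) := by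
  classical
  simp only [primPowerSum_induce hf]
  rw [← Finset.powerset_univ, sum_moebius, inducedPowerSum]
  refine powerSum_congr hf k ?_
  rw [Finset.coe_univ]
  exact ⟨(SimpleGraph.induceUnivIso G).symm⟩

/-- This is where the grading of the logarithmic derivative enters. -/
lemma primPowerSum_eq_zero_of_card (hf : IsLinearlyBoundedExpType f) {k : ℕ} (hk : 1 ≤ k)
    {V : Type} [Fintype V] (G : SimpleGraph V) (hV : k + 1 < Fintype.card V) :
    primPowerSum f k G = 0 := by
  classical
  exact (isBinomialFamily_inducedPoly hf G).moebius_powerSum hk (B := Finset.univ) hV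

lemma powerSum_eq_zero_of_subsingleton (hf : IsLinearlyBoundedExpType f) {k : ℕ} (hk : 1 ≤ k)
    {V : Type} [Finite V] [Subsingleton V] (G : SimpleGraph V) : powerSum f k G = 0 := by
  classical
  have := Fintype.ofFinite V
  have hΦ := isBinomialFamily_inducedPoly hf G
  have h : powerSum f k G = inducedPowerSum f k G Finset.univ := by
    refine powerSum_congr hf k ?_
    rw [Finset.coe_univ]
    exact ⟨(SimpleGraph.induceUnivIso G).symm⟩
  rw [h]
  change ((inducedPoly f G Finset.univ).roots.map _).sum = 0
  rcases isEmpty_or_nonempty V with hV | ⟨⟨v⟩⟩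
  · rw [Finset.univ_eq_empty, hΦ.empty]
    simp
  · have : (Finset.univ : Finset V) = {v} := by
      ext a; simp [Subsingleton.elim a v]
    rw [this, hΦ.singleton]
    simp; omega

lemma primPowerSum_eq_zero_of_subsingleton (hf : IsLinearlyBoundedExpType f) {k : ℕ} (hk : 1 ≤ k)
    {V : Type} [Fintype V] [Subsingleton V] (G : SimpleGraph V) : primPowerSum f k G = 0 :=
  Finset.sum_eq_zero fun A _ => by
    rw [inducedPowerSum, powerSum_eq_zero_of_subsingleton hf hk, mul_zero]

/-- Power sums are additive over a decomposition of the nodes without crossing edges. -/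
lemma inducedPowerSum_eq_add (hf : IsLinearlyBoundedExpType f) (k : ℕ) {V : Type} [DecidableEq V]
    {G : SimpleGraph V} {s : Set V} [DecidablePred (· ∈ s)]
    (hs : ∀ u v, G.Adj u v → (u ∈ s ↔ v ∈ s)) (A : Finset V) :
    inducedPowerSum f k G A = inducedPowerSum f k G (A.filter (· ∈ s)) +
      inducedPowerSum f k G (A.filter (· ∉ s)) := by
  rw [inducedPowerSum, inducedPowerSum, inducedPowerSum, ← powerSum_sum hf]
  refine powerSum_congr hf k ⟨RelIso.symm ⟨⟨Sum.elim
      (fun x => ⟨x.1, (Finset.mem_filter.mp x.2).1⟩) (fun x => ⟨x.1, (Finset.mem_filter.mp x.2).1⟩),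
    fun x => if h : x.1 ∈ s then .inl ⟨x.1, Finset.mem_filter.mpr ⟨x.2, h⟩⟩
      else .inr ⟨x.1, Finset.mem_filter.mpr ⟨x.2, h⟩⟩, ?_, ?_⟩, ?_⟩⟩
  · rintro (⟨x, hx⟩ | ⟨x, hx⟩)
    · have := (Finset.mem_filter.mp hx).2
      simp [this]
    · have := (Finset.mem_filter.mp hx).2
      simp [this]
  · rintro ⟨x, hx⟩
    by_cases h : x ∈ s <;> simp [h]
  · rintro (⟨x, hx⟩ | ⟨x, hx⟩) (⟨y, hy⟩ | ⟨y, hy⟩)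
    · simp
    · have h1 := (Finset.mem_filter.mp hx).2
      have h2 := (Finset.mem_filter.mp hy).2
      simpa using fun h => h2 ((hs _ _ h).mp h1)
    · have h1 := (Finset.mem_filter.mp hx).2
      have h2 := (Finset.mem_filter.mp hy).2
      simpa using fun h => h1 ((hs _ _ h).mpr h2)
    · simp

/-- Additivity of `p_k` makes its Möbius transform vanish on disconnected graphs. -/
lemma primPowerSum_eq_zero_of_not_connected (hf : IsLinearlyBoundedExpType f) {k : ℕ} (hk : 1 ≤ k)
    {V : Type} [Fintype V] {G : SimpleGraph V} (hG : ¬ G.Connected) : primPowerSum f k G = 0 := by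
  classical
  rcases isEmpty_or_nonempty V with hV | hV
  · exact primPowerSum_eq_zero_of_subsingleton hf hk G
  rw [SimpleGraph.connected_iff, not_and_or, SimpleGraph.Preconnected] at hG
  push Not at hG
  obtain ⟨u, v, huv⟩ := hG.resolve_right (by simp)
  set s : Set V := {x | G.Reachable u x} with hsdef
  have hs : ∀ x y, G.Adj x y → (x ∈ s ↔ y ∈ s) := fun x y h =>
    ⟨fun hx => hx.trans h.reachable, fun hy => hy.trans h.symm.reachable⟩
  have hus : u ∈ s := SimpleGraph.Reachable.refl u
  have hvs : v ∉ s := huv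
  have h := moebius_sub (inducedPowerSum f k G)
    (fun A => inducedPowerSum f k G (A.filter (· ∈ s))) Finset.univ
  have h0 : moebius (fun A => inducedPowerSum f k G (A.filter (· ∈ s))) Finset.univ = 0 :=
    moebius_eq_zero_of_insert (Finset.mem_univ v) fun A _ => by
      rw [Finset.filter_insert, if_neg hvs]
  rw [h0, sub_zero] at h
  rw [primPowerSum, ← h]
  refine moebius_eq_zero_of_insert (Finset.mem_univ u) fun A _ => ?_
  simp only [inducedPowerSum_eq_add hf k hs (insert u A), inducedPowerSum_eq_add hf k hs A,
    add_sub_cancel_left]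
  rw [Finset.filter_insert, if_neg (not_not.mpr hus)]

end PowerSum

/-! ### Injective homomorphisms and the coefficients of the power sums -/

section InjCount

lemma injCount_congr {U U' V V' : Type} {F : SimpleGraph U} {F' : SimpleGraph U'}
    {G : SimpleGraph V} {G' : SimpleGraph V'} (e : F ≃g F') (e' : G ≃g G') :
    injCount F G = injCount F' G' := by
  refine Nat.card_congr ⟨fun φ => ⟨(e'.toHom.comp φ.1).comp e.symm.toHom, ?_⟩,
    fun φ => ⟨(e'.symm.toHom.comp φ.1).comp e.toHom, ?_⟩, ?_, ?_⟩
  · exact (e'.injective.comp φ.2).comp e.symm.injective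
  · exact (e'.symm.injective.comp φ.2).comp e.injective
  · intro φ
    ext x
    simp
  · intro φ
    ext x
    simp

lemma injCount_self_ne_zero {U : Type} [Finite U] (F : SimpleGraph U) : injCount F F ≠ 0 := by
  have : Nonempty {φ : F →g F // Function.Injective φ} :=
    ⟨⟨SimpleGraph.Hom.id, Function.injective_id⟩⟩
  have : Finite {φ : F →g F // Function.Injective φ} := Subtype.finite
  exact Nat.card_pos.ne'

/-- Injective homomorphisms are sorted by their images. -/
lemma injCount_eq_sum_induce {V : Type} [Fintype V] [DecidableEq V] {m : ℕ}
    (F : SimpleGraph (Fin m)) (G : SimpleGraph V) :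
    injCount F G = ∑ S : Finset V with S.card = m, injCount F (G.induce (S : Set V)) := by
  set I := {φ : F →g G // Function.Injective φ} with hI
  have : Finite I := Subtype.finite
  let im : I → Finset V := fun φ => Finset.univ.image φ.1
  have hcard : ∀ φ : I, (im φ).card = m := fun φ => by
    simp only [im]
    rw [Finset.card_image_of_injective _ φ.2, Finset.card_univ, Fintype.card_fin]
  rw [injCount, Nat.card_congr (Equiv.sigmaFiberEquiv im).symm, Nat.card_sigma,
    Finset.sum_filter]
  refine Finset.sum_congr rfl fun S _ => ?_
  split_ifs with hS
  · refine Nat.card_congr ⟨fun φ => ⟨⟨fun x => ⟨φ.1.1 x, ?_⟩, fun h => φ.1.1.map_adj h⟩, ?_⟩,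
      fun ψ => ⟨⟨(SimpleGraph.Embedding.induce (S : Set V)).toHom.comp ψ.1, ?_⟩, ?_⟩, ?_, ?_⟩
    · have : φ.1.1 x ∈ im φ.1 := Finset.mem_image_of_mem _ (Finset.mem_univ x)
      rw [φ.2] at this
      exact this
    · intro x y h
      exact φ.1.2 (congrArg Subtype.val h)
    · exact Subtype.val_injective.comp ψ.2
    · refine Finset.eq_of_subset_of_card_le ?_ (by rw [hcard, hS])
      intro a ha
      obtain ⟨x, -, rfl⟩ := Finset.mem_image.mp ha
      exact (ψ.1 x).2
    · intro φ
      rfl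
    · intro ψ
      rfl
  · rw [Nat.card_eq_zero]
    left
    exact ⟨fun φ => hS (by rw [← φ.2]; exact hcard φ.1)⟩

section SameSize

variable {m : ℕ} {F G : SimpleGraph (Fin m)}

lemma exists_iso_map_le_of_injCount_ne_zero (h : injCount F G ≠ 0) :
    ∃ σ : Equiv.Perm (Fin m), F.map σ.toEmbedding ≤ G := by
  obtain ⟨⟨φ, hφ⟩⟩ := (Nat.card_ne_zero.mp h).1
  refine ⟨Equiv.ofBijective φ (Finite.injective_iff_bijective.mp hφ), ?_⟩
  rw [SimpleGraph.map_le_iff_le_comap]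
  intro x y hxy
  exact φ.map_adj hxy

lemma connected_of_injCount_ne_zero (h : injCount F G ≠ 0) (hF : F.Connected) : G.Connected := by
  obtain ⟨σ, hσ⟩ := exists_iso_map_le_of_injCount_ne_zero h
  exact ((SimpleGraph.Iso.map σ F).connected_iff.mp hF).mono hσ

lemma ncard_edgeSet_map (σ : Equiv.Perm (Fin m)) :
    (F.map σ.toEmbedding).edgeSet.ncard = F.edgeSet.ncard := by
  rw [SimpleGraph.edgeSet_map]
  exact Set.ncard_image_of_injective _ (Function.Embedding.injective _)

lemma ncard_edgeSet_le_of_injCount_ne_zero (h : injCount F G ≠ 0) :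
    F.edgeSet.ncard ≤ G.edgeSet.ncard := by
  obtain ⟨σ, hσ⟩ := exists_iso_map_le_of_injCount_ne_zero h
  rw [← ncard_edgeSet_map σ]
  exact Set.ncard_le_ncard (SimpleGraph.edgeSet_mono hσ) (Set.toFinite _)

lemma nonempty_iso_of_injCount_ne_zero (h : injCount F G ≠ 0)
    (hE : G.edgeSet.ncard ≤ F.edgeSet.ncard) : Nonempty (F ≃g G) := by
  obtain ⟨σ, hσ⟩ := exists_iso_map_le_of_injCount_ne_zero h
  have h1 : (F.map σ.toEmbedding).edgeSet = G.edgeSet :=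
    Set.eq_of_subset_of_ncard_le (SimpleGraph.edgeSet_mono hσ)
      (by rw [ncard_edgeSet_map]; exact hE) (Set.toFinite _)
  rw [SimpleGraph.edgeSet_inj] at h1
  exact h1 ▸ ⟨SimpleGraph.Iso.map σ F⟩

end SameSize

lemma GraphClass.nonempty_rep_iso {m : ℕ} (G : SimpleGraph (Fin m)) :
    Nonempty (GraphClass.rep (Quotient.mk (graphIsoSetoid m) G) ≃g G) :=
  Quotient.exact (s := graphIsoSetoid m) (Quotient.out_eq (s := graphIsoSetoid m) _)

lemma GraphClass.eq_of_iso {m : ℕ} {F F' : GraphClass m} (h : Nonempty (F.rep ≃g F'.rep)) :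
    F = F' := by
  exact (Quotient.out_eq (s := graphIsoSetoid m) F).symm.trans
    ((Quotient.sound (s := graphIsoSetoid m) h).trans (Quotient.out_eq (s := graphIsoSetoid m) F'))

open Classical in
/-- The numbers `inj(F, G)`, for `F` and `G` of the same size, form a triangular system with
respect to the number of edges; an isomorphism invariant vanishing on disconnected graphs is
therefore a combination of those with `F` connected. -/
lemma exists_coeff_of_invariant {m : ℕ} (Q : SimpleGraph (Fin m) → ℂ)
    (hQ : ∀ F G : SimpleGraph (Fin m), Nonempty (F ≃g G) → Q F = Q G)
    (hQ0 : ∀ G, ¬ G.Connected → Q G = 0) :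
    ∃ c : GraphClass m → ℂ, ∀ G : SimpleGraph (Fin m),
      Q G = ∑ F : GraphClass m with F.rep.Connected, c F * (injCount F.rep G : ℂ) := by
  have key : ∀ n : ℕ, ∃ c : GraphClass m → ℂ, ∀ G : SimpleGraph (Fin m), G.edgeSet.ncard < n →
      Q G = ∑ F : GraphClass m with F.rep.Connected, c F * (injCount F.rep G : ℂ) := by
    intro n
    induction n with
    | zero => exact ⟨0, fun G h => absurd h (by omega)⟩
    | succ n ih =>
      obtain ⟨c, hc⟩ := ih
      let r : GraphClass m → ℂ := fun F => Q F.rep - ∑ F' : GraphClass m with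
        F'.rep.Connected ∧ F'.rep.edgeSet.ncard < n, c F' * (injCount F'.rep F.rep : ℂ)
      refine ⟨fun F => if F.rep.edgeSet.ncard < n then c F else r F / injCount F.rep F.rep,
        fun G hG => ?_⟩
      rcases Nat.lt_succ_iff_lt_or_eq.mp hG with hlt | heq
      · rw [hc G hlt]
        refine Finset.sum_congr rfl fun F _ => ?_
        by_cases h0 : injCount F.rep G = 0
        · simp [h0]
        · beta_reduce
          rw [if_pos ((ncard_edgeSet_le_of_injCount_ne_zero h0).trans_lt hlt)]
      · by_cases hconn : G.Connected
        · set F₀ : GraphClass m := Quotient.mk (graphIsoSetoid m) G with hF₀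
          obtain ⟨e⟩ := GraphClass.nonempty_rep_iso G
          have hF₀conn : F₀.rep.Connected := e.connected_iff.mpr hconn
          have hF₀G : ∀ F : GraphClass m, injCount F.rep F₀.rep = injCount F.rep G :=
            fun F => injCount_congr (SimpleGraph.Iso.refl) e
          have hE : ¬ F₀.rep.edgeSet.ncard < n := by
            have := ncard_edgeSet_le_of_injCount_ne_zero
              (F := G) (G := F₀.rep) (by rw [injCount_congr e.symm SimpleGraph.Iso.refl]
                                         exact injCount_self_ne_zero _)
            omega
          rw [← Finset.sum_filter_add_sum_filter_not _ fun F => F.rep.edgeSet.ncard < n,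
            Finset.filter_filter, Finset.filter_filter]
          have h1 : ∑ F : GraphClass m with F.rep.Connected ∧ F.rep.edgeSet.ncard < n,
              (if F.rep.edgeSet.ncard < n then c F else r F / injCount F.rep F.rep) *
                (injCount F.rep G : ℂ) = Q G - r F₀ := by
            have hr : r F₀ = Q G - ∑ F : GraphClass m with
                F.rep.Connected ∧ F.rep.edgeSet.ncard < n, c F * (injCount F.rep G : ℂ) := by
              have hQF : Q F₀.rep = Q G := hQ _ _ ⟨e⟩
              simp only [r, hQF, hF₀G]
            rw [hr, sub_sub_cancel]
            refine Finset.sum_congr rfl fun F hF => ?_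
            rw [if_pos (Finset.mem_filter.mp hF).2.2]
          have h2 : ∑ F : GraphClass m with F.rep.Connected ∧ ¬ F.rep.edgeSet.ncard < n,
              (if F.rep.edgeSet.ncard < n then c F else r F / injCount F.rep F.rep) *
                (injCount F.rep G : ℂ) = r F₀ := by
            rw [Finset.sum_eq_single F₀]
            · rw [if_neg hE, ← hF₀G, div_mul_cancel₀]
              exact_mod_cast injCount_self_ne_zero _
            · intro F hF hne
              have : injCount F.rep G = 0 := by
                by_contra h0
                obtain ⟨e'⟩ := nonempty_iso_of_injCount_ne_zero h0
                  (by have := (Finset.mem_filter.mp hF).2.2; omega)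
                exact hne (GraphClass.eq_of_iso ⟨e'.trans e.symm⟩)
              simp [this]
            · intro h
              exact absurd (Finset.mem_filter.mpr ⟨Finset.mem_univ _, hF₀conn, hE⟩) h
          rw [h1, h2, sub_add_cancel]
        · rw [hQ0 G hconn]
          refine (Finset.sum_eq_zero fun F hF => ?_).symm
          have : injCount F.rep G = 0 := by
            by_contra h0
            exact hconn (connected_of_injCount_ne_zero h0 (Finset.mem_filter.mp hF).2)
          simp [this]
  -- A graph on `m` nodes has at most `|Sym2 (Fin m)|` edges.
  obtain ⟨c, hc⟩ := key (Nat.card (Sym2 (Fin m)) + 1)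
  exact ⟨c, fun G => hc G (Nat.lt_succ_of_le (Set.ncard_le_card _))⟩

/-- Existence of the coefficients `c_k(F)`. -/
theorem exists_isPowerSumCoeff {f : GraphPolynomial} (hf : IsLinearlyBoundedExpType f) :
    ∃ c : ℕ → ∀ {m : ℕ}, GraphClass m → ℂ, IsPowerSumCoeff f c := by
  classical
  have hex : ∀ k m : ℕ, ∃ c : GraphClass m → ℂ, 1 ≤ k → ∀ G : SimpleGraph (Fin m),
      primPowerSum f k G =
        ∑ F : GraphClass m with F.rep.Connected, c F * (injCount F.rep G : ℂ) := by
    intro k m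
    by_cases hk : 1 ≤ k
    · obtain ⟨c, hc⟩ := exists_coeff_of_invariant (m := m) (fun G => primPowerSum f k G)
        (fun F G ⟨e⟩ => primPowerSum_congr hf k e)
        (fun G hG => primPowerSum_eq_zero_of_not_connected hf hk hG)
      exact ⟨c, fun _ => hc⟩
    · exact ⟨0, fun h => absurd h hk⟩
  choose c hc using hex
  refine ⟨fun k {m} F => if k = 0 then 1 else c k m F, fun F => if_pos rfl, fun k hk V _ G => ?_⟩
  have := Fintype.ofFinite V
  have hk0 : k ≠ 0 := by omega
  simp only [if_neg hk0]
  have hS : ∀ (m : ℕ) (S : Finset V), S.card = m → primPowerSum f k (G.induce (S : Set V)) =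
      ∑ F : GraphClass m with F.rep.Connected,
        c k m F * (injCount F.rep (G.induce (S : Set V)) : ℂ) := by
    intro m S hSm
    have hcard : Fintype.card ((S : Set V) : Type) = m := by simpa using hSm
    let e := SimpleGraph.Iso.map (Fintype.equivFinOfCardEq hcard) (G.induce (S : Set V))
    rw [primPowerSum_congr hf k e, hc k m hk]
    refine Finset.sum_congr rfl fun F _ => ?_
    rw [injCount_congr SimpleGraph.Iso.refl e]
  have hvanish : ∀ S : Finset V, S.card ∉ Finset.Icc 2 (k + 1) →
      primPowerSum f k (G.induce (S : Set V)) = 0 := by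
    intro S hSc
    rw [Finset.mem_Icc, not_and_or] at hSc
    rcases hSc with h | h
    · have : Subsingleton ((S : Set V) : Type) := by
        rw [← Fintype.card_le_one_iff_subsingleton]
        simpa using (by omega : S.card ≤ 1)
      exact primPowerSum_eq_zero_of_subsingleton hf hk _
    · refine primPowerSum_eq_zero_of_card hf hk _ ?_
      simpa using h
  rw [powerSum_eq_sum_primPowerSum hf,
    ← Finset.sum_filter_add_sum_filter_not _ fun S : Finset V => S.card ∈ Finset.Icc 2 (k + 1),
    Finset.sum_eq_zero (s := Finset.univ.filter fun S : Finset V => ¬ S.card ∈ Finset.Icc 2 (k + 1))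
      (fun S hS' => hvanish S (Finset.mem_filter.mp hS').2), add_zero,
    ← Finset.sum_fiberwise_of_maps_to (t := Finset.Icc 2 (k + 1)) (g := Finset.card)
      (fun S hS' => (Finset.mem_filter.mp hS').2)]
  refine Finset.sum_congr rfl fun m hm => ?_
  have hfilt : (Finset.univ.filter fun S : Finset V => S.card ∈ Finset.Icc 2 (k + 1)).filter
      (fun S => S.card = m) = Finset.univ.filter fun S : Finset V => S.card = m := by
    ext S
    simp only [Finset.mem_filter, Finset.mem_univ, true_and]
    exact ⟨fun h => h.2, fun h => ⟨h ▸ hm, h⟩⟩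
  rw [hfilt, Finset.sum_congr rfl fun S hS' => hS m S (Finset.mem_filter.mp hS').2,
    Finset.sum_comm]
  refine Finset.sum_congr rfl fun F _ => ?_
  rw [injCount_eq_sum_induce, Nat.cast_sum, Finset.mul_sum]

end InjCount

/-! ### The bound on the roots -/

/-- All roots are at most `6 |b| d` in absolute value; the bound on linear coefficients is
applied to `⌊d⌋`. -/
theorem exists_isRootBound {f : GraphPolynomial} (hf : IsLinearlyBoundedExpType f) :
    ∃ C : ℝ, IsRootBound f C := by
  classical
  obtain ⟨b, hb⟩ := hf.bounded
  refine ⟨6 * |b|, fun V _ G d hd z hz => ?_⟩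
  have := Fintype.ofFinite V
  have hd0 : 0 ≤ d := zero_le_one.trans hd.1
  have hΦ := isBinomialFamily_inducedPoly hf G
  by_contra hlt
  push Not at hlt
  refine hΦ.eval_ne_zero (β := |b| * d) (x := z) (by positivity) (by linarith) ?_ Finset.univ ?_
  · intro A v t ht
    have hD : ∀ v : V, (G.neighborSet v).ncard ≤ ⌊d⌋₊ := fun v => Nat.le_floor (hd.2 v)
    calc ∑ S ∈ A.powerset with v ∈ S ∧ S.card = t, ‖linCoeff (inducedPoly f G) S‖
        ≤ ∑ S : Finset V with v ∈ S ∧ S.card = t, ‖linCoeff (inducedPoly f G) S‖ :=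
          Finset.sum_le_sum_of_subset_of_nonneg
            (Finset.filter_subset_filter _ (Finset.subset_univ _)) fun _ _ _ => norm_nonneg _
      _ ≤ (b * ⌊d⌋₊) ^ (t - 1) := hb V G _ hD v t ht
      _ ≤ |b * ⌊d⌋₊| ^ (t - 1) := by rw [← abs_pow]; exact le_abs_self _
      _ ≤ (|b| * d) ^ (t - 1) := by
          rw [abs_mul, Nat.abs_cast]
          gcongr
          exact Nat.floor_le hd0
  · have h : inducedPoly f G Finset.univ = f V G := by
      refine hf.iso_inv _ _ _ _ ?_
      rw [Finset.coe_univ]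
      exact ⟨SimpleGraph.induceUnivIso G⟩
    rw [h]
    exact isRoot_of_mem_roots hz

/-! ### Counting homomorphisms of connected graphs -/

section HomCount

variable {U V : Type} {F : SimpleGraph U} {G : SimpleGraph V}

lemma exists_adj_dist_lt (hF : F.Connected) {i u : U} (hu : u ≠ i) :
    ∃ p, F.Adj p u ∧ F.dist p i < F.dist u i := by
  obtain ⟨w, hw⟩ := hF.exists_walk_length_eq_dist u i
  cases w with
  | nil => exact absurd rfl hu
  | cons h w =>
    rw [SimpleGraph.Walk.length_cons] at hw
    exact ⟨_, h.symm, (SimpleGraph.dist_le w).trans_lt (by omega)⟩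

lemma exists_injOn_fin {s : Set V} (hs : s.Finite) {D : ℕ} (hD : 0 < D) (h : s.ncard ≤ D) :
    ∃ e : V → Fin D, Set.InjOn e s := by
  classical
  have : Finite s := hs
  have hc : Nat.card s ≤ D := h
  let e : s → Fin D := fun x => Fin.castLE hc (Finite.equivFin s x)
  have he : Function.Injective e :=
    (Fin.castLE_injective hc).comp (Finite.equivFin s).injective
  refine ⟨fun x => if hx : x ∈ s then e ⟨x, hx⟩ else ⟨0, hD⟩, fun x hx y hy hxy => ?_⟩
  simp only [dif_pos hx, dif_pos hy] at hxy
  exact congrArg Subtype.val (he hxy)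

/-- A homomorphism from a connected graph is determined by the image of a root `i` and, for every
other node, the position of its image among the neighbours of the image of its parent; nodes in
`J`, whose images are determined by that of `i`, need not be recorded. -/
lemma card_hom_le [Finite U] [Finite V] (hF : F.Connected) {D : ℕ} (hD : 0 < D)
    (hG : ∀ v, (G.neighborSet v).ncard ≤ D) (i : U) (J : Set U) (P : Set (F →g G))
    (hJ : ∀ φ ∈ P, ∀ ψ ∈ P, φ i = ψ i → ∀ u ∈ J, φ u = ψ u) :
    Nat.card P ≤ Nat.card V * D ^ Nat.card {u // u ≠ i ∧ u ∉ J} := by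
  choose p hp using fun u : {u // u ≠ i} => exists_adj_dist_lt hF u.2
  choose e he using fun v => exists_injOn_fin (Set.toFinite (G.neighborSet v)) hD (hG v)
  let code : P → V × ({u // u ≠ i ∧ u ∉ J} → Fin D) :=
    fun φ => (φ.1 i, fun u => e (φ.1 (p ⟨u.1, u.2.1⟩)) (φ.1 u.1))
  have hcode : Function.Injective code := by
    intro φ ψ h
    have h1 : φ.1 i = ψ.1 i := congrArg Prod.fst h
    have h2 := congrArg Prod.snd h
    have key : ∀ n : ℕ, ∀ u, F.dist u i = n → φ.1 u = ψ.1 u := by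
      intro n
      induction n using Nat.strong_induction_on with
      | _ n ih =>
        intro u hu
        by_cases hui : u = i
        · rw [hui, h1]
        by_cases huJ : u ∈ J
        · exact hJ _ φ.2 _ ψ.2 h1 u huJ
        · obtain ⟨hadj, hlt⟩ := hp ⟨u, hui⟩
          have h3 := ih _ (hu ▸ hlt) _ rfl
          have h4 := congrFun h2 ⟨u, hui, huJ⟩
          simp only [code] at h4
          rw [← h3] at h4
          exact he _ (φ.1.map_adj hadj) (h3 ▸ ψ.1.map_adj hadj) h4
    exact Subtype.ext (RelHom.ext fun u => key _ u rfl)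
  refine (Nat.card_le_card_of_injective code hcode).trans_eq ?_
  rw [Nat.card_prod, Nat.card_fun, Nat.card_fin]

lemma homCount_le [Finite U] [Finite V] (hF : F.Connected) {D : ℕ} (hD : 0 < D)
    (hG : ∀ v, (G.neighborSet v).ncard ≤ D) :
    homCount F G ≤ Nat.card V * D ^ (Nat.card U - 1) := by
  obtain ⟨i⟩ := hF.nonempty
  have h := card_hom_le hF hD hG i ∅ Set.univ (by simp)
  have hc : Nat.card {u // u ≠ i ∧ u ∉ (∅ : Set U)} = Nat.card U - 1 := by
    have := Fintype.ofFinite U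
    classical
    simp [Fintype.card_subtype_compl]
  rwa [hc, Nat.card_univ] at h

lemma card_hom_eq_le [Finite U] [Finite V] (hF : F.Connected) {D : ℕ} (hD : 0 < D)
    (hG : ∀ v, (G.neighborSet v).ncard ≤ D) {i j : U} (hij : i ≠ j) :
    Nat.card {φ : F →g G | φ i = φ j} ≤ Nat.card V * D ^ (Nat.card U - 2) := by
  have h := card_hom_le hF hD hG i {j} {φ : F →g G | φ i = φ j} (by
    rintro φ hφ ψ hψ h u rfl
    exact Eq.trans (Eq.symm hφ) (h.trans hψ))
  have hc : Nat.card {u // u ≠ i ∧ u ∉ ({j} : Set U)} = Nat.card U - 2 := by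
    have := Fintype.ofFinite U
    classical
    have e : (Finset.univ.filter fun u => u ≠ i ∧ u ∉ ({j} : Set U)) = ({i, j} : Finset U)ᶜ := by
      ext u; simp
    rw [Nat.card_eq_fintype_card, Fintype.card_subtype, e, Finset.card_compl,
      Finset.card_pair hij, Nat.card_eq_fintype_card]
  rwa [hc] at h

lemma injCount_le_homCount [Finite U] [Finite V] : injCount F G ≤ homCount F G :=
  Nat.card_le_card_of_injective _ Subtype.val_injective

lemma homCount_le_injCount_add [Finite U] [Finite V] (hF : F.Connected) {D : ℕ} (hD : 0 < D)
    (hG : ∀ v, (G.neighborSet v).ncard ≤ D) :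
    homCount F G * D ≤ injCount F G * D +
      Nat.card U ^ 2 * (Nat.card V * D ^ (Nat.card U - 1)) := by
  classical
  have := Fintype.ofFinite U
  have hsplit : (Set.univ : Set (F →g G)) ⊆ {φ | Function.Injective φ} ∪
      ⋃ q ∈ (Finset.univ.filter fun q : U × U => q.1 ≠ q.2), {φ : F →g G | φ q.1 = φ q.2} := by
    intro φ _
    by_cases h : Function.Injective φ
    · exact Or.inl h
    · obtain ⟨a, b, hab, hne⟩ := Function.not_injective_iff.mp h
      exact Or.inr (Set.mem_biUnion (x := (a, b)) (by simpa using hne) hab)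
  have h1 : homCount F G ≤ injCount F G +
      ∑ q : U × U with q.1 ≠ q.2, Nat.card {φ : F →g G | φ q.1 = φ q.2} := by
    have h2 := (Set.ncard_le_ncard hsplit (Set.toFinite _)).trans (Set.ncard_union_le _ _)
    rw [Set.ncard_univ] at h2
    exact h2.trans (Nat.add_le_add_left (Finset.set_ncard_biUnion_le _ _) _)
  have h3 : (∑ q : U × U with q.1 ≠ q.2, Nat.card {φ : F →g G | φ q.1 = φ q.2}) * D ≤
      Nat.card U ^ 2 * (Nat.card V * D ^ (Nat.card U - 1)) := by
    rw [Finset.sum_mul]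
    calc ∑ q : U × U with q.1 ≠ q.2, Nat.card {φ : F →g G | φ q.1 = φ q.2} * D
        ≤ ∑ q : U × U with q.1 ≠ q.2, Nat.card V * D ^ (Nat.card U - 1) := by
          refine Finset.sum_le_sum fun q hq => ?_
          have hne := (Finset.mem_filter.mp hq).2
          have h2 : 2 ≤ Nat.card U := by
            rw [Nat.card_eq_fintype_card]
            exact Fintype.one_lt_card_iff.mpr ⟨_, _, hne⟩
          have h4 : Nat.card U - 1 = Nat.card U - 2 + 1 := by omega
          rw [h4, pow_succ, ← mul_assoc]
          exact Nat.mul_le_mul_right D (card_hom_eq_le hF hD hG hne)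
      _ ≤ ∑ q : U × U, Nat.card V * D ^ (Nat.card U - 1) :=
          Finset.sum_le_sum_of_subset (Finset.filter_subset _ _)
      _ = _ := by
          rw [Finset.sum_const, Finset.card_univ, Fintype.card_prod,
            ← Nat.card_eq_fintype_card (α := U), smul_eq_mul, sq]
  calc homCount F G * D ≤ _ := Nat.mul_le_mul_right D h1
    _ ≤ _ := by rw [add_mul]; exact Nat.add_le_add_left h3 _

variable {d : ℝ}

lemma IsAdmissible.floor (h : IsAdmissible G d) :
    0 < ⌊d⌋₊ ∧ ∀ v, (G.neighborSet v).ncard ≤ ⌊d⌋₊ :=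
  ⟨Nat.floor_pos.mpr h.1, fun v => Nat.le_floor (h.2 v)⟩

lemma injCount_le_of_isAdmissible [Finite U] [Finite V] (hF : F.Connected)
    (h : IsAdmissible G d) : (injCount F G : ℝ) ≤ Nat.card V * d ^ (Nat.card U - 1) := by
  have h1 := (injCount_le_homCount (F := F) (G := G)).trans (homCount_le hF h.floor.1 h.floor.2)
  calc (injCount F G : ℝ) ≤ Nat.card V * (⌊d⌋₊ : ℝ) ^ (Nat.card U - 1) := by exact_mod_cast h1
    _ ≤ _ := by
      gcongr
      exact Nat.floor_le (zero_le_one.trans h.1)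

/-- Injective homomorphisms have the same density as homomorphisms up to `O(1 / d)`. The number
`2` compensates for the integer part of `d`. -/
lemma abs_injDensity_sub_homDensity_le [Finite U] [Finite V] [Nonempty V] (hF : F.Connected)
    (h : IsAdmissible G d) :
    |(injCount F G : ℝ) / (Nat.card V * d ^ (Nat.card U - 1)) - homDensity F G d| ≤
      2 * (Nat.card U : ℝ) ^ 2 / d := by
  have hd : 0 < d := zero_lt_one.trans_le h.1
  have hV : 0 < (Nat.card V : ℝ) := by exact_mod_cast Nat.card_pos
  have hD1 : (1 : ℝ) ≤ ⌊d⌋₊ := by exact_mod_cast h.floor.1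
  have hD0 : (0 : ℝ) < ⌊d⌋₊ := by linarith
  have hDd : (⌊d⌋₊ : ℝ) ≤ d := Nat.floor_le hd.le
  have hdD : d ≤ 2 * ⌊d⌋₊ := by have := Nat.lt_floor_add_one d; linarith
  have h1 : (injCount F G : ℝ) ≤ homCount F G := by
    exact_mod_cast injCount_le_homCount (F := F) (G := G)
  have h2 : (homCount F G : ℝ) * ⌊d⌋₊ ≤ injCount F G * ⌊d⌋₊ +
      Nat.card U ^ 2 * (Nat.card V * (⌊d⌋₊ : ℝ) ^ (Nat.card U - 1)) := by
    exact_mod_cast homCount_le_injCount_add hF h.floor.1 h.floor.2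
  set m := Nat.card U
  have h3 : ((homCount F G : ℝ) - injCount F G) * ⌊d⌋₊ ≤
      (m : ℝ) ^ 2 * (Nat.card V * d ^ (m - 1)) := by
    have : (m : ℝ) ^ 2 * (Nat.card V * (⌊d⌋₊ : ℝ) ^ (m - 1)) ≤
        (m : ℝ) ^ 2 * (Nat.card V * d ^ (m - 1)) := by gcongr
    linarith
  rw [homDensity, abs_sub_comm, ← sub_div, abs_of_nonneg (div_nonneg (by linarith) (by positivity)),
    div_le_div_iff₀ (by positivity) hd]
  calc ((homCount F G : ℝ) - injCount F G) * d
      ≤ ((homCount F G : ℝ) - injCount F G) * (2 * ⌊d⌋₊) :=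
        mul_le_mul_of_nonneg_left hdD (by linarith)
    _ ≤ 2 * (m : ℝ) ^ 2 * (Nat.card V * d ^ (m - 1)) := by linarith

end HomCount

/-! ### Averages over multisets and root measures -/

section Average

variable {E : Type*} [NormedAddCommGroup E] [NormedSpace ℝ E]

/-- The average of `g` over a multiset of complex numbers. -/
noncomputable def multisetAvg (s : Multiset ℂ) (g : ℂ → E) : E :=
  (s.card : ℝ)⁻¹ • (s.map g).sum

lemma multisetAvg_add (s : Multiset ℂ) (g h : ℂ → E) :
    multisetAvg s (fun z => g z + h z) = multisetAvg s g + multisetAvg s h := by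
  rw [multisetAvg, Multiset.sum_map_add, smul_add]; rfl

lemma multisetAvg_sub (s : Multiset ℂ) (g h : ℂ → E) :
    multisetAvg s (fun z => g z - h z) = multisetAvg s g - multisetAvg s h := by
  rw [multisetAvg, Multiset.sum_map_sub, smul_sub]; rfl

lemma multisetAvg_clm {E' : Type*} [NormedAddCommGroup E'] [NormedSpace ℝ E'] (l : E →L[ℝ] E')
    (s : Multiset ℂ) (g : ℂ → E) : multisetAvg s (fun z => l (g z)) = l (multisetAvg s g) := by
  rw [multisetAvg, multisetAvg, map_smul, map_multiset_sum, Multiset.map_map]; rfl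

lemma norm_multisetAvg_le {s : Multiset ℂ} {g : ℂ → E} {ε : ℝ} (hε : 0 ≤ ε)
    (H : ∀ z ∈ s, ‖g z‖ ≤ ε) : ‖multisetAvg s g‖ ≤ ε := by
  have h1 : ‖(s.map g).sum‖ ≤ s.card * ε := by
    induction s using Multiset.induction_on with
    | empty => simp
    | cons a s ih =>
      rw [Multiset.map_cons, Multiset.sum_cons, Multiset.card_cons]
      have h2 := ih fun z hz => H z (Multiset.mem_cons_of_mem hz)
      have h3 := H a (Multiset.mem_cons_self a s)
      push_cast
      linarith [norm_add_le (g a) (s.map g).sum]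
  rw [multisetAvg, norm_smul, norm_inv, RCLike.norm_natCast]
  calc (s.card : ℝ)⁻¹ * ‖(s.map g).sum‖ ≤ (s.card : ℝ)⁻¹ * (s.card * ε) := by gcongr
    _ = ((s.card : ℝ)⁻¹ * s.card) * ε := by ring
    _ ≤ 1 * ε := by gcongr; exact inv_mul_le_one
    _ = ε := one_mul ε

lemma integral_multiset_sum_dirac [CompleteSpace E] (s : Multiset ℂ) (g : ℂ → E) :
    Integrable g (s.map fun z => Measure.dirac z).sum ∧
      ∫ z, g z ∂(s.map fun z => Measure.dirac z).sum = (s.map g).sum := by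
  induction s using Multiset.induction_on with
  | empty => simp
  | cons a s ih =>
    rw [Multiset.map_cons, Multiset.sum_cons, Multiset.map_cons, Multiset.sum_cons]
    have ha : Integrable g (Measure.dirac a) := integrable_dirac (by simp)
    exact ⟨ha.add_measure ih.1, by rw [integral_add_measure ha ih.1, ih.2, integral_dirac]⟩

end Average

section RootMeasure

variable {f : GraphPolynomial} {V : Type} [Finite V] {G : SimpleGraph V} {d : ℝ}

/-- The roots of `f(G, x)`, divided by `d`. -/
noncomputable def scaledRoots (f : GraphPolynomial) (G : SimpleGraph V) (d : ℝ) : Multiset ℂ :=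
  (f V G).roots.map fun z => z / (d : ℂ)

lemma card_scaledRoots (hf : IsLinearlyBoundedExpType f) :
    (scaledRoots f G d).card = Nat.card V := by
  rw [scaledRoots, Multiset.card_map, ← hf.natDegree_eq V G,
    (IsAlgClosed.splits (f V G)).natDegree_eq_card_roots]

lemma rootMeasure_eq :
    rootMeasure f G d = (Nat.card V : ENNReal)⁻¹ •
      ((scaledRoots f G d).map fun z => Measure.dirac z).sum := by
  rw [rootMeasure, scaledRoots, Multiset.map_map]; rfl

lemma integral_rootMeasure {E : Type*} [NormedAddCommGroup E] [NormedSpace ℝ E] [CompleteSpace E]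
    (hf : IsLinearlyBoundedExpType f) (g : ℂ → E) :
    ∫ z, g z ∂(rootMeasure f G d) = multisetAvg (scaledRoots f G d) g := by
  rw [rootMeasure_eq, integral_smul_measure, (integral_multiset_sum_dirac _ g).2, multisetAvg,
    card_scaledRoots hf]
  simp

lemma norm_le_of_mem_scaledRoots {C : ℝ} (hC : IsRootBound f C) (hd : IsAdmissible G d) {z : ℂ}
    (hz : z ∈ scaledRoots f G d) : ‖z‖ ≤ C := by
  obtain ⟨w, hw, rfl⟩ := Multiset.mem_map.mp hz
  have hd0 : 0 < d := zero_lt_one.trans_le hd.1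
  rw [norm_div, Complex.norm_real, Real.norm_of_nonneg hd0.le, div_le_iff₀ hd0]
  exact hC V G d hd w hw

lemma multisetAvg_pow_scaledRoots (hf : IsLinearlyBoundedExpType f) (k : ℕ) :
    multisetAvg (scaledRoots f G d) (fun z => z ^ k) =
      powerSum f k G / ((Nat.card V : ℂ) * (d : ℂ) ^ k) := by
  rw [multisetAvg, card_scaledRoots hf, scaledRoots, Multiset.map_map, powerSum]
  have h : (((fun z : ℂ => z ^ k) ∘ fun z : ℂ => z / (d : ℂ))) =
      fun z => ((d : ℂ) ^ k)⁻¹ * z ^ k := by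
    ext z
    simp only [Function.comp_apply, div_pow]
    ring
  rw [h, Multiset.sum_map_mul_left, Complex.real_smul]
  push_cast
  rw [div_eq_mul_inv, mul_inv]
  ring

lemma measure_multiset_sum_dirac (s : Multiset ℂ) {A : Set ℂ} (hA : MeasurableSet A) :
    (∀ z ∈ s, z ∈ A) → (s.map fun z => Measure.dirac z).sum A = s.card ∧
      (s.map fun z => Measure.dirac z).sum Aᶜ = 0 := by
  induction s using Multiset.induction_on with
  | empty => simp
  | cons a s ih =>
    intro h
    have h1 := ih fun z hz => h z (Multiset.mem_cons_of_mem hz)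
    have ha : a ∈ A := h a (Multiset.mem_cons_self a s)
    rw [Multiset.map_cons, Multiset.sum_cons, Measure.add_apply, Measure.add_apply, h1.1, h1.2,
      Measure.dirac_apply' a hA, Measure.dirac_apply' a hA.compl]
    simp [ha, add_comm]

lemma isProbabilityMeasure_rootMeasure [Nonempty V] (hf : IsLinearlyBoundedExpType f) :
    IsProbabilityMeasure (rootMeasure f G d) := by
  refine ⟨?_⟩
  rw [rootMeasure_eq, Measure.smul_apply,
    (measure_multiset_sum_dirac _ MeasurableSet.univ fun _ _ => Set.mem_univ _).1,
    card_scaledRoots hf, smul_eq_mul]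
  exact ENNReal.inv_mul_cancel (by exact_mod_cast Nat.card_pos.ne') (ENNReal.natCast_ne_top _)

lemma rootMeasure_compl_closedBall {C : ℝ} (hC : IsRootBound f C) (hd : IsAdmissible G d) :
    rootMeasure f G d (Metric.closedBall 0 C)ᶜ = 0 := by
  rw [rootMeasure_eq, Measure.smul_apply, (measure_multiset_sum_dirac _
    Metric.isClosed_closedBall.measurableSet fun z hz => by
      rw [mem_closedBall_zero_iff]; exact norm_le_of_mem_scaledRoots hC hd hz).2, smul_zero]

end RootMeasure

/-! ### Convergence of moments -/

section Moments

variable {V : ℕ → Type} [∀ n, Finite (V n)] [∀ n, Nonempty (V n)] {G : ∀ n, SimpleGraph (V n)}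
  {d : ℕ → ℝ}

lemma homDensity_of_subsingleton {U W : Type} [Unique U] [Finite W] [Nonempty W]
    (F : SimpleGraph U) (H : SimpleGraph W) (d : ℝ) : homDensity F H d = 1 := by
  have h : homCount F H = Nat.card W := by
    refine Nat.card_congr ⟨fun φ => φ default, fun w => ⟨fun _ => w, fun {a b} hab => ?_⟩, ?_, ?_⟩
    · rw [Subsingleton.elim a b] at hab
      exact absurd hab (F.loopless.irrefl b)
    · intro φ
      ext x
      exact congrArg φ (Subsingleton.elim _ _)
    · intro w
      rfl
  have hW : (Nat.card W : ℝ) ≠ 0 := by exact_mod_cast Nat.card_pos.ne'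
  rw [homDensity, h, Nat.card_unique (α := U), Nat.sub_self, pow_zero, mul_one, div_self hW]

/-- The number of copies of a connected graph on `m ≤ k` nodes is of smaller order than `v d ^ k`.
-/
lemma tendsto_injCount_div_zero {m k : ℕ} (hmk : m ≤ k) (hm : 1 ≤ m) {F : SimpleGraph (Fin m)}
    (hF : F.Connected) (hG : ∀ n, IsAdmissible (G n) (d n)) (hd : Tendsto d atTop atTop) :
    Tendsto (fun n => (injCount F (G n) : ℝ) / (Nat.card (V n) * d n ^ k)) atTop (𝓝 0) := by
  refine squeeze_zero (fun n => ?_) (fun n => ?_) hd.inv_tendsto_atTop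
  · have := zero_le_one.trans (hG n).1
    positivity
  · have hd1 := (hG n).1
    have hd0 : 0 < d n := zero_lt_one.trans_le hd1
    have hV : 0 < (Nat.card (V n) : ℝ) := by exact_mod_cast Nat.card_pos
    have h := injCount_le_of_isAdmissible hF (hG n)
    rw [Nat.card_fin] at h
    rw [Pi.inv_apply, inv_eq_one_div, div_le_div_iff₀ (by positivity) hd0, one_mul]
    calc (injCount F (G n) : ℝ) * d n ≤ Nat.card (V n) * d n ^ (m - 1) * d n := by gcongr
      _ = Nat.card (V n) * d n ^ m := by
        rw [mul_assoc, ← pow_succ, Nat.sub_add_cancel hm]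
      _ ≤ Nat.card (V n) * d n ^ k := by gcongr

lemma tendsto_injCount_div {k : ℕ} {F : SimpleGraph (Fin (k + 1))}
    (hF : F.Connected) (hG : ∀ n, IsAdmissible (G n) (d n)) (hd : Tendsto d atTop atTop) {t : ℝ}
    (ht : Tendsto (fun n => homDensity F (G n) (d n)) atTop (𝓝 t)) :
    Tendsto (fun n => (injCount F (G n) : ℝ) / (Nat.card (V n) * d n ^ k)) atTop (𝓝 t) := by
  have h0 : Tendsto (fun n => (injCount F (G n) : ℝ) / (Nat.card (V n) * d n ^ k) -
      homDensity F (G n) (d n)) atTop (𝓝 0) := by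
    refine squeeze_zero_norm (fun n => ?_) (hd.const_div_atTop (2 * (k + 1 : ℝ) ^ 2))
    have := abs_injDensity_sub_homDensity_le hF (hG n)
    simpa using this
  simpa using h0.add ht

open Classical in
/-- In `p_k(G) / (v(G) d ^ k)` only the connected graphs with `k + 1` nodes survive in the limit. -/
theorem tendsto_moment {f : GraphPolynomial} (hf : IsLinearlyBoundedExpType f)
    {c : ℕ → ∀ {m : ℕ}, GraphClass m → ℂ} (hc : IsPowerSumCoeff f c)
    (hG : ∀ n, IsAdmissible (G n) (d n)) (hd : Tendsto d atTop atTop)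
    {t : ∀ {m : ℕ}, GraphClass m → ℝ}
    (ht : ∀ (k : ℕ) (F : GraphClass (k + 1)), F.rep.Connected → c k F ≠ 0 →
      Tendsto (fun n => homDensity F.rep (G n) (d n)) atTop (𝓝 (t F))) (k : ℕ) :
    Tendsto (fun n => multisetAvg (scaledRoots f (G n) (d n)) (fun z => z ^ k)) atTop
      (𝓝 (∑ F : GraphClass (k + 1) with F.rep.Connected, c k F * (t F : ℂ))) := by
  rcases Nat.eq_zero_or_pos k with rfl | hk
  · -- Only the one-node graph contributes, and its density is `1`.
    have hcon : ∀ F : SimpleGraph (Fin 1), F.Connected := fun F =>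
      (SimpleGraph.connected_iff F).mpr ⟨fun a b => by rw [Subsingleton.elim a b], ⟨0⟩⟩
    have h1 : ∀ F : GraphClass 1, t F = 1 := by
      intro F
      have h := ht 0 F (hcon _) (by rw [hc.1]; exact one_ne_zero)
      have h' : ∀ n, homDensity F.rep (G n) (d n) = 1 := fun n =>
        homDensity_of_subsingleton (U := Fin 1) F.rep (G n) (d n)
      exact tendsto_nhds_unique (h.congr h') tendsto_const_nhds
    let F₀ : GraphClass (0 + 1) := Quotient.mk (graphIsoSetoid 1) ⊥
    have h2 : (Finset.univ.filter fun F : GraphClass (0 + 1) => F.rep.Connected) = {F₀} := by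
      ext F
      rw [Finset.mem_filter, Finset.mem_singleton]
      refine ⟨fun _ => GraphClass.eq_of_iso ?_, fun _ => ⟨Finset.mem_univ _, hcon _⟩⟩
      have : ∀ F F' : SimpleGraph (Fin 1), Nonempty (F ≃g F') := fun F F' => by
        rw [Subsingleton.elim F F']; exact ⟨SimpleGraph.Iso.refl⟩
      exact this _ _
    rw [h2, Finset.sum_singleton, hc.1, h1]
    refine tendsto_const_nhds.congr fun n => ?_
    simp [multisetAvg, card_scaledRoots hf]
  have hexp : ∀ n, multisetAvg (scaledRoots f (G n) (d n)) (fun z => z ^ k) =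
      ∑ m ∈ Finset.Icc 2 (k + 1), ∑ F : GraphClass m with F.rep.Connected, c k F *
        (((injCount F.rep (G n) : ℝ) / (Nat.card (V n) * d n ^ k) : ℝ) : ℂ) := by
    intro n
    rw [multisetAvg_pow_scaledRoots hf, hc.2 k hk, Finset.sum_div]
    refine Finset.sum_congr rfl fun m _ => ?_
    rw [Finset.sum_div]
    refine Finset.sum_congr rfl fun F _ => ?_
    push_cast
    ring
  simp only [hexp]
  rw [← zero_add (∑ F : GraphClass (k + 1) with F.rep.Connected, c k F * (t F : ℂ))]
  simp only [Finset.sum_Icc_succ_top (show 2 ≤ k + 1 by omega)]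
  refine Tendsto.add ?_ ?_
  · rw [← Finset.sum_const_zero (s := Finset.Icc 2 k)]
    refine tendsto_finsetSum _ fun m hm => ?_
    rw [Finset.mem_Icc] at hm
    rw [← Finset.sum_const_zero (s := Finset.univ.filter fun F : GraphClass m => F.rep.Connected)]
    refine tendsto_finsetSum _ fun F hF => ?_
    have h := (Complex.continuous_ofReal.tendsto 0).comp (tendsto_injCount_div_zero hm.2 (by omega)
      (Finset.mem_filter.mp hF).2 hG hd)
    simpa using h.const_mul (c k F)
  · refine tendsto_finsetSum _ fun F hF => ?_
    by_cases h0 : c k F = 0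
    · simp [h0]
    · have hcon := (Finset.mem_filter.mp hF).2
      exact ((Complex.continuous_ofReal.tendsto _).comp
        (tendsto_injCount_div hcon hG hd (ht k F hcon h0))).const_mul _

end Moments

/-! ### Convergence of averages of harmonic and continuous functions -/

section Approximation

/-- A real harmonic function on a disc, continuous up to the boundary, is a uniform limit of real
parts of polynomials: a slightly dilated copy `g(r z)` is the real part of a holomorphic function
on a neighbourhood of the closed disc, which is approximated by its Taylor polynomials. -/
lemma exists_polynomial_re_near {g : ℂ → ℝ} {C ε : ℝ}
    (hc : ContinuousOn g (Metric.closedBall 0 C))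
    (hg : InnerProductSpace.HarmonicOnNhd g (Metric.ball 0 C)) (hε : 0 < ε) :
    ∃ P : ℂ[X], ∀ z ∈ Metric.closedBall (0 : ℂ) C, |g z - (P.eval z).re| ≤ ε := by
  rcases le_or_gt C 0 with hC | hC
  · refine ⟨Polynomial.C (g 0 : ℂ), fun z hz => ?_⟩
    have : z = 0 := norm_le_zero_iff.mp ((mem_closedBall_zero_iff.mp hz).trans hC)
    simp [this, hε.le]
  obtain ⟨δ, hδ, hunif⟩ := Metric.uniformContinuousOn_iff.mp
    ((isCompact_closedBall (0 : ℂ) C).uniformContinuousOn_of_continuous hc) (ε / 2) (half_pos hε)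
  obtain ⟨F, hF, hFg⟩ := hg.exists_analyticOnNhd_ball_re_eq
  obtain ⟨r, hr1, hr0, hrδ⟩ : ∃ r : ℝ, r < 1 ∧ 0 < r ∧ (1 - r) * C < δ := by
    refine ⟨max (1 / 2) (1 - δ / (2 * C)), max_lt (by norm_num) ?_, lt_max_of_lt_left (by norm_num),
      ?_⟩
    · have : 0 < δ / (2 * C) := by positivity
      linarith
    · calc (1 - max (1 / 2) (1 - δ / (2 * C))) * C ≤ δ / (2 * C) * C := by
            gcongr
            linarith [le_max_right (1 / 2 : ℝ) (1 - δ / (2 * C))]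
        _ = δ / 2 := by field_simp
        _ < δ := half_lt_self hδ
  have hrC : r * C < C := by nlinarith
  obtain ⟨R, hR1, hR2⟩ := exists_between hrC
  obtain ⟨R', hR'1, hR'2⟩ := exists_between hR1
  have hrC0 : 0 < r * C := by positivity
  have hR'0 : 0 < R' := hrC0.trans hR'1
  have hR0 : 0 < R := hR'0.trans hR'2
  have hdiff : DifferentiableOn ℂ F (Metric.closedBall 0 ((⟨R, hR0.le⟩ : NNReal) : ℝ)) :=
    hF.differentiableOn.mono (Metric.closedBall_subset_ball hR2)
  obtain ⟨p, hser⟩ : ∃ p, HasFPowerSeriesOnBall F p 0 (ENNReal.ofNNReal ⟨R, hR0.le⟩) :=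
    ⟨_, hdiff.hasFPowerSeriesOnBall (by exact_mod_cast hR0)⟩
  have htay := hser.tendstoUniformlyOn (r' := ⟨R', hR'0.le⟩)
    (ENNReal.coe_lt_coe.mpr (NNReal.coe_lt_coe.mp hR'2))
  obtain ⟨n, hn⟩ := (Metric.tendstoUniformlyOn_iff.mp htay (ε / 2) (half_pos hε)).exists
  refine ⟨∑ k ∈ Finset.range n, Polynomial.C (p.coeff k) * (Polynomial.C (r : ℂ) * X) ^ k,
    fun z hz => ?_⟩
  rw [mem_closedBall_zero_iff] at hz
  have hnorm : ‖(r : ℂ) * z‖ ≤ r * C := by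
    rw [norm_mul, Complex.norm_real, Real.norm_of_nonneg hr0.le]
    gcongr
  have h1 := hn ((r : ℂ) * z) (by
    rw [mem_ball_zero_iff]
    exact hnorm.trans_lt hR'1)
  rw [zero_add, FormalMultilinearSeries.partialSum, dist_eq_norm] at h1
  simp only [FormalMultilinearSeries.apply_eq_pow_smul_coeff, smul_eq_mul] at h1
  have h2 : |g z - g ((r : ℂ) * z)| < ε / 2 := by
    refine hunif z (mem_closedBall_zero_iff.mpr hz) _
      (mem_closedBall_zero_iff.mpr (hnorm.trans hrC.le)) ?_
    rw [dist_eq_norm, ← one_sub_mul, norm_mul, ← Complex.ofReal_one, ← Complex.ofReal_sub,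
      Complex.norm_real, Real.norm_of_nonneg (by linarith)]
    calc (1 - r) * ‖z‖ ≤ (1 - r) * C := by gcongr
      _ < δ := hrδ
  have h3 : (F ((r : ℂ) * z)).re = g ((r : ℂ) * z) :=
    hFg (mem_ball_zero_iff.mpr (hnorm.trans_lt hrC))
  have h4 := (Complex.abs_re_le_norm _).trans_lt h1
  rw [Complex.sub_re, h3] at h4
  have h5 : (∑ k ∈ Finset.range n,
      Polynomial.C (p.coeff k) * (Polynomial.C (r : ℂ) * X) ^ k).eval z =
      ∑ k ∈ Finset.range n, ((r : ℂ) * z) ^ k * p.coeff k := by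
    rw [eval_finsetSum]
    refine Finset.sum_congr rfl fun k _ => ?_
    rw [eval_mul, eval_C, eval_pow, eval_mul, eval_C, eval_X, mul_comm]
  rw [h5]
  refine (abs_sub_le _ (g ((r : ℂ) * z)) _).trans ?_
  linarith

variable {s : ℕ → Multiset ℂ} {C : ℝ}

/-- Averages converge for uniform limits of functions whose averages converge. -/
lemma exists_tendsto_multisetAvg_of_approx {E : Type*} [NormedAddCommGroup E] [NormedSpace ℝ E]
    [CompleteSpace E] {g : ℂ → E}
    (H : ∀ ε > 0, ∃ h : ℂ → E, (∀ n, ∀ z ∈ s n, ‖g z - h z‖ ≤ ε) ∧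
      ∃ L, Tendsto (fun n => multisetAvg (s n) h) atTop (𝓝 L)) :
    ∃ L, Tendsto (fun n => multisetAvg (s n) g) atTop (𝓝 L) := by
  refine cauchySeq_tendsto_of_complete (Metric.cauchySeq_iff'.mpr fun ε hε => ?_)
  obtain ⟨h, hgh, L, hL⟩ := H (ε / 4) (by positivity)
  obtain ⟨N, hN⟩ := Metric.cauchySeq_iff'.mp hL.cauchySeq (ε / 4) (by positivity)
  refine ⟨N, fun n hn => ?_⟩
  have key : ∀ n, dist (multisetAvg (s n) g) (multisetAvg (s n) h) ≤ ε / 4 := fun n => by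
    rw [dist_eq_norm, ← multisetAvg_sub]
    exact norm_multisetAvg_le (by positivity) (hgh n)
  have h1 := dist_triangle4 (multisetAvg (s n) g) (multisetAvg (s n) h) (multisetAvg (s N) h)
    (multisetAvg (s N) g)
  have h2 := key n
  have h3 := key N
  rw [dist_comm] at h3
  have h4 := hN n hn
  linarith

lemma exists_tendsto_multisetAvg_eval
    (hmom : ∀ k : ℕ, ∃ L : ℂ, Tendsto (fun n => multisetAvg (s n) (fun z => z ^ k)) atTop (𝓝 L))
    (P : ℂ[X]) : ∃ L : ℂ, Tendsto (fun n => multisetAvg (s n) (fun z => P.eval z)) atTop (𝓝 L) := by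
  induction P using Polynomial.induction_on' with
  | add p q hp hq =>
    obtain ⟨L, hL⟩ := hp
    obtain ⟨M, hM⟩ := hq
    refine ⟨L + M, ?_⟩
    simp only [eval_add, multisetAvg_add]
    exact hL.add hM
  | monomial k a =>
    obtain ⟨L, hL⟩ := hmom k
    refine ⟨a * L, ?_⟩
    simp only [eval_monomial]
    have h := fun n => multisetAvg_clm (ContinuousLinearMap.mul ℝ ℂ a) (s n) (fun z => z ^ k)
    simp only [ContinuousLinearMap.mul_apply'] at h
    simp only [h]
    exact hL.const_mul a

lemma exists_tendsto_multisetAvg_eval_re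
    (hmom : ∀ k : ℕ, ∃ L : ℂ, Tendsto (fun n => multisetAvg (s n) (fun z => z ^ k)) atTop (𝓝 L))
    (P : ℂ[X]) :
    ∃ L : ℝ, Tendsto (fun n => multisetAvg (s n) (fun z => (P.eval z).re)) atTop (𝓝 L) := by
  obtain ⟨L, hL⟩ := exists_tendsto_multisetAvg_eval hmom P
  refine ⟨L.re, ?_⟩
  have h := fun n => multisetAvg_clm Complex.reCLM (s n) (fun z => P.eval z)
  simp only [Complex.reCLM_apply] at h
  simp only [h]
  exact (Complex.continuous_re.tendsto L).comp hL

lemma exists_tendsto_multisetAvg_harmonic_real (hs : ∀ n, ∀ z ∈ s n, ‖z‖ ≤ C)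
    (hmom : ∀ k : ℕ, ∃ L : ℂ, Tendsto (fun n => multisetAvg (s n) (fun z => z ^ k)) atTop (𝓝 L))
    {g : ℂ → ℝ} (hc : ContinuousOn g (Metric.closedBall 0 C))
    (hg : InnerProductSpace.HarmonicOnNhd g (Metric.ball 0 C)) :
    ∃ L : ℝ, Tendsto (fun n => multisetAvg (s n) g) atTop (𝓝 L) := by
  refine exists_tendsto_multisetAvg_of_approx fun ε hε => ?_
  obtain ⟨P, hP⟩ := exists_polynomial_re_near hc hg hε
  exact ⟨_, fun n z hz => hP z (mem_closedBall_zero_iff.mpr (hs n z hz)),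
    exists_tendsto_multisetAvg_eval_re hmom P⟩

lemma exists_tendsto_multisetAvg_harmonic (hs : ∀ n, ∀ z ∈ s n, ‖z‖ ≤ C)
    (hmom : ∀ k : ℕ, ∃ L : ℂ, Tendsto (fun n => multisetAvg (s n) (fun z => z ^ k)) atTop (𝓝 L))
    {g : ℂ → ℂ} (hc : ContinuousOn g (Metric.closedBall 0 C))
    (hg : InnerProductSpace.HarmonicOnNhd g (Metric.ball 0 C)) :
    ∃ L : ℂ, Tendsto (fun n => multisetAvg (s n) g) atTop (𝓝 L) := by
  obtain ⟨a, ha⟩ := exists_tendsto_multisetAvg_harmonic_real hs hmom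
    (Complex.continuous_re.comp_continuousOn hc) (hg.comp_CLM Complex.reCLM)
  obtain ⟨b, hb⟩ := exists_tendsto_multisetAvg_harmonic_real hs hmom
    (Complex.continuous_im.comp_continuousOn hc) (hg.comp_CLM Complex.imCLM)
  refine ⟨(a : ℂ) + b * Complex.I, ?_⟩
  have h : ∀ n, multisetAvg (s n) g = ((multisetAvg (s n) (Complex.re ∘ g) : ℝ) : ℂ) +
      ((multisetAvg (s n) (Complex.im ∘ g) : ℝ) : ℂ) * Complex.I := by
    intro n
    have h1 := multisetAvg_clm Complex.reCLM (s n) g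
    have h2 := multisetAvg_clm Complex.imCLM (s n) g
    change multisetAvg (s n) (Complex.re ∘ g) = (multisetAvg (s n) g).re at h1
    change multisetAvg (s n) (Complex.im ∘ g) = (multisetAvg (s n) g).im at h2
    rw [h1, h2, Complex.re_add_im]
  simp only [h]
  exact ((Complex.continuous_ofReal.tendsto a).comp ha).add
    (((Complex.continuous_ofReal.tendsto b).comp hb).mul_const _)

/-- On real points, all continuous functions are uniform limits of polynomials. -/
lemma exists_tendsto_multisetAvg_of_real (hs : ∀ n, ∀ z ∈ s n, ‖z‖ ≤ C)
    (hmom : ∀ k : ℕ, ∃ L : ℂ, Tendsto (fun n => multisetAvg (s n) (fun z => z ^ k)) atTop (𝓝 L))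
    (hreal : ∀ n, ∀ z ∈ s n, z.im = 0) {g : ℂ → ℝ} (hg : Continuous g) :
    ∃ L : ℝ, Tendsto (fun n => multisetAvg (s n) g) atTop (𝓝 L) := by
  refine exists_tendsto_multisetAvg_of_approx fun ε hε => ?_
  obtain ⟨p, hp⟩ := exists_polynomial_near_of_continuousOn (-C) C (fun x => g (x : ℂ))
    (hg.comp Complex.continuous_ofReal).continuousOn ε hε
  refine ⟨_, fun n z hz => ?_, exists_tendsto_multisetAvg_eval_re hmom (p.map Complex.ofRealHom)⟩
  obtain ⟨x, rfl⟩ : ∃ x : ℝ, z = (x : ℂ) := ⟨z.re, Complex.ext rfl (by simp [hreal n z hz])⟩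
  have hx : |x| ≤ C := by simpa using hs n _ hz
  have h1 : ((p.map Complex.ofRealHom).eval (x : ℂ)).re = p.eval x := by
    have : (x : ℂ) = Complex.ofRealHom x := rfl
    rw [this, eval_map_apply]
    exact Complex.ofReal_re _
  rw [h1, norm_sub_rev]
  exact (hp x (abs_le.mp hx)).le

end Approximation

section Limits

variable {f : GraphPolynomial} {V : ℕ → Type} [∀ n, Finite (V n)] [∀ n, Nonempty (V n)]
  {G : ∀ n, SimpleGraph (V n)} {d : ℕ → ℝ} {C : ℝ}

/-- The normalized absolute value of `f(G, ξ d)` is the exponential of the average of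
`log |ξ - z|` over the scaled roots. -/
lemma norm_eval_rpow_div {W : Type} [Finite W] [Nonempty W] (hf : IsLinearlyBoundedExpType f)
    (hC : IsRootBound f C) {H : SimpleGraph W} {d : ℝ} (hd : IsAdmissible H d) {ξ : ℂ}
    (hξ : C < ‖ξ‖) :
    ‖(f W H).eval (ξ * (d : ℂ))‖ ^ (1 / (Nat.card W : ℝ)) / d =
      Real.exp (multisetAvg (scaledRoots f H d) fun z => Real.log ‖ξ - z‖) := by
  have hd0 : 0 < d := zero_lt_one.trans_le hd.1
  have hdC : (d : ℂ) ≠ 0 := by exact_mod_cast hd0.ne'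
  have hW : (Nat.card W : ℝ) ≠ 0 := by exact_mod_cast Nat.card_pos.ne'
  have hroots : (f W H).roots = (scaledRoots f H d).map fun z => (d : ℂ) * z := by
    rw [scaledRoots, Multiset.map_map]
    conv_lhs => rw [← Multiset.map_id (f W H).roots]
    refine Multiset.map_congr rfl fun z _ => ?_
    simp only [id, Function.comp_apply]
    field_simp
  have hprod : ∀ s : Multiset ℂ, (∀ z ∈ s, ξ - z ≠ 0) →
      ‖((s.map fun z => (d : ℂ) * z).map fun a => ξ * (d : ℂ) - a).prod‖ =
        Real.exp ((s.map fun z => Real.log ‖ξ - z‖).sum) * d ^ s.card := by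
    intro s hs
    induction s using Multiset.induction_on with
    | empty => simp
    | cons a s ih =>
      have h1 := ih fun z hz => hs z (Multiset.mem_cons_of_mem hz)
      have h2 : 0 < ‖ξ - a‖ := norm_pos_iff.mpr (hs a (Multiset.mem_cons_self a s))
      rw [Multiset.map_cons, Multiset.map_cons, Multiset.prod_cons, norm_mul, h1,
        Multiset.map_cons, Multiset.sum_cons, Real.exp_add, Real.exp_log h2, Multiset.card_cons,
        mul_comm (d : ℂ) a, ← sub_mul, norm_mul, Complex.norm_real, Real.norm_of_nonneg hd0.le]
      ring
  rw [(IsAlgClosed.splits (f W H)).eval_eq_prod_roots_of_monic (hf.monic _ _), hroots,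
    hprod _ fun z hz h0 => ?_, card_scaledRoots hf,
    Real.mul_rpow (Real.exp_pos _).le (by positivity), ← Real.rpow_natCast, ← Real.rpow_mul hd0.le,
    mul_one_div_cancel hW, Real.rpow_one, mul_div_assoc, div_self hd0.ne', mul_one,
    ← Real.exp_mul, multisetAvg, card_scaledRoots hf, smul_eq_mul]
  · congr 1
    ring
  · have := norm_le_of_mem_scaledRoots hC hd hz
    rw [← sub_eq_zero.mp h0] at this
    linarith

lemma exists_tendsto_norm_eval (hf : IsLinearlyBoundedExpType f) (hC : IsRootBound f C)
    (hG : ∀ n, IsAdmissible (G n) (d n))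
    (hmom : ∀ k : ℕ, ∃ L : ℂ, Tendsto
      (fun n => multisetAvg (scaledRoots f (G n) (d n)) (fun z => z ^ k)) atTop (𝓝 L))
    {ξ : ℂ} (hξ : C < ‖ξ‖) :
    ∃ L : ℝ, 0 < L ∧ Tendsto (fun n =>
      ‖(f (V n) (G n)).eval (ξ * (d n : ℂ))‖ ^ (1 / (Nat.card (V n) : ℝ)) / d n) atTop (𝓝 L) := by
  have hne : ∀ z ∈ Metric.closedBall (0 : ℂ) C, ξ - z ≠ 0 := by
    intro z hz h0
    rw [mem_closedBall_zero_iff, ← sub_eq_zero.mp h0] at hz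
    linarith
  have hharm : InnerProductSpace.HarmonicOnNhd (fun z : ℂ => Real.log ‖ξ - z‖)
      (Metric.closedBall 0 C) := fun z hz =>
    AnalyticAt.harmonicAt_log_norm (analyticAt_const.sub analyticAt_id) (hne z hz)
  obtain ⟨L, hL⟩ := exists_tendsto_multisetAvg_harmonic_real
    (fun n z hz => norm_le_of_mem_scaledRoots hC (hG n) hz) hmom hharm.continuousOn
    (hharm.mono Metric.ball_subset_closedBall)
  refine ⟨Real.exp L, Real.exp_pos L, ?_⟩
  simp only [norm_eval_rpow_div hf hC (hG _) hξ]
  exact (Real.continuous_exp.tendsto L).comp hL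

/-- Weak convergence for real roots. The limit is taken along an ultrafilter, which is possible
by compactness as all the measures live on one disc; since all integrals converge, it is the limit
of the whole sequence. -/
lemma exists_weak_limit (hf : IsLinearlyBoundedExpType f) (hC : IsRootBound f C)
    (hG : ∀ n, IsAdmissible (G n) (d n))
    (hmom : ∀ k : ℕ, ∃ L : ℂ, Tendsto
      (fun n => multisetAvg (scaledRoots f (G n) (d n)) (fun z => z ^ k)) atTop (𝓝 L))
    (hreal : ∀ n, ∀ z ∈ (f (V n) (G n)).roots, z.im = 0) :
    ∃ ν : ProbabilityMeasure ℂ, ∀ g : BoundedContinuousFunction ℂ ℝ,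
      Tendsto (fun n => ∫ z, g z ∂(rootMeasure f (G n) (d n))) atTop
        (𝓝 (∫ z, g z ∂(ν : Measure ℂ))) := by
  let μ : ℕ → ProbabilityMeasure ℂ := fun n =>
    ⟨rootMeasure f (G n) (d n), isProbabilityMeasure_rootMeasure hf⟩
  have htight : IsTightMeasureSet
      {((ρ : ProbabilityMeasure ℂ) : Measure ℂ) | ρ ∈ Set.range μ} := by
    rw [isTightMeasureSet_iff_exists_isCompact_measure_compl_le]
    refine fun ε _ => ⟨Metric.closedBall 0 C, isCompact_closedBall 0 C, ?_⟩
    rintro _ ⟨_, ⟨n, rfl⟩, rfl⟩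
    exact (rootMeasure_compl_closedBall hC (hG n)).trans_le zero_le
  let 𝒰 : Ultrafilter ℕ := Ultrafilter.of atTop
  obtain ⟨ν, -, hν⟩ := (isCompact_closure_of_isTightMeasureSet htight).ultrafilter_le_nhds
    (𝒰.map μ) (by
      rw [le_principal_iff]
      exact Filter.mem_map.mpr (Filter.univ_mem' fun n => subset_closure ⟨n, rfl⟩))
  have hν' : Tendsto μ 𝒰 (𝓝 ν) := hν
  refine ⟨ν, fun g => ?_⟩
  have hreal' : ∀ n, ∀ z ∈ scaledRoots f (G n) (d n), z.im = 0 := by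
    intro n z hz
    obtain ⟨w, hw, rfl⟩ := Multiset.mem_map.mp hz
    rw [Complex.div_ofReal_im, hreal n w hw, zero_div]
  obtain ⟨L, hL⟩ := exists_tendsto_multisetAvg_of_real
    (fun n z hz => norm_le_of_mem_scaledRoots hC (hG n) hz) hmom hreal' g.continuous
  simp only [← integral_rootMeasure hf] at hL
  have h1 := (ProbabilityMeasure.tendsto_iff_forall_integral_tendsto.mp hν') g
  rw [← tendsto_nhds_unique (hL.mono_left (Ultrafilter.of_le atTop)) h1]
  exact hL

end Limits

open Classical in
theorem mainTheorem2 (f : GraphPolynomial) (hf : IsLinearlyBoundedExpType f) :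
    (∃ c : ℕ → ∀ {m : ℕ}, GraphClass m → ℂ, IsPowerSumCoeff f c) ∧
    (∃ C : ℝ, IsRootBound f C) ∧
    ∀ (c : ℕ → ∀ {m : ℕ}, GraphClass m → ℂ), IsPowerSumCoeff f c →
    ∀ (C : ℝ), IsRootBound f C →
    ∀ (V : ℕ → Type) [∀ n, Finite (V n)] [∀ n, Nonempty (V n)]
      (G : ∀ n, SimpleGraph (V n)) (d : ℕ → ℝ),
      (∀ n, IsAdmissible (G n) (d n)) →
      Tendsto d atTop atTop →
    ∀ (t : ∀ {m : ℕ}, GraphClass m → ℝ),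
      (∀ (k : ℕ) (F : GraphClass (k + 1)), F.rep.Connected → c k F ≠ 0 →
        Tendsto (fun n => homDensity F.rep (G n) (d n)) atTop (𝓝 (t F))) →
    (∀ k : ℕ, Tendsto (fun n => ∫ z, z ^ k ∂(rootMeasure f (G n) (d n))) atTop
      (𝓝 (∑ F : GraphClass (k + 1) with F.rep.Connected, c k F * (t F : ℂ)))) ∧
    (∀ g : ℂ → ℂ, ContinuousOn g (Metric.closedBall 0 C) →
      InnerProductSpace.HarmonicOnNhd g (Metric.ball 0 C) →
      ∃ L : ℂ, Tendsto (fun n => ∫ z, g z ∂(rootMeasure f (G n) (d n))) atTop (𝓝 L)) ∧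
    (∀ ξ : ℂ, C < ‖ξ‖ → ∃ L : ℝ, 0 < L ∧
      Tendsto (fun n => ‖(f (V n) (G n)).eval (ξ * (d n : ℂ))‖ ^ (1 / (Nat.card (V n) : ℝ)) / d n)
        atTop (𝓝 L)) ∧
    ((∀ n, ∀ z ∈ (f (V n) (G n)).roots, z.im = 0) →
      ∃ ν : ProbabilityMeasure ℂ, ∀ g : BoundedContinuousFunction ℂ ℝ,
        Tendsto (fun n => ∫ z, g z ∂(rootMeasure f (G n) (d n))) atTop
          (𝓝 (∫ z, g z ∂(ν : Measure ℂ)))) := by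
  refine ⟨exists_isPowerSumCoeff hf, exists_isRootBound hf, ?_⟩
  intro c hc C hC V _ _ G d hG hd t ht
  have hmom := tendsto_moment hf hc hG hd ht
  have hmom' : ∀ k : ℕ, ∃ L : ℂ, Tendsto
      (fun n => multisetAvg (scaledRoots f (G n) (d n)) (fun z => z ^ k)) atTop (𝓝 L) :=
    fun k => ⟨_, hmom k⟩
  refine ⟨fun k => ?_, fun g hgc hg => ?_, fun ξ hξ => ?_, fun hreal => ?_⟩
  · simp only [integral_rootMeasure hf]
    exact hmom k
  · simp only [integral_rootMeasure hf]
    exact exists_tendsto_multisetAvg_harmonic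
      (fun n z hz => norm_le_of_mem_scaledRoots hC (hG n) hz) hmom' hgc hg
  · exact exists_tendsto_norm_eval hf hC hG hmom' hξ
  · exact exists_weak_limit hf hC hG hmom' hreal
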